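/- Let $N\ge 1$ and $D_1,\dots,D_N\ge 1$ be integers and put $D=D_1+\dots+D_N$. Let $\lambda:\mathrm{Spin}(D)\to SO(D)$, $\lambda(x)v=xvx^{-1}$, be the two-fold covering. Let $\widetilde H=SO(D_1)\times\cdots\times SO(D_N)\subset SO(D)$ be the subgroup of block diagonal matrices, and let $\widetilde G=\mathrm{Spin}(D_1)\times\cdots\times\mathrm{Spin}(D_N)$ be regarded as a subgroup of $\mathrm{Spin}(D)$ inside $\mathrm{C\ell}(D)=\mathrm{C\ell}(D_1)\widehat\otimes\cdots\widehat\otimes\mathrm{C\ell}(D_N)$, i.e. as the group of all products $x_1\cdots x_N=x_1\otimes\cdots\otimes x_N$ with $x_i\in\mathrm{Spin}(D_i)$ (the image of the multiplication homomorphism from the direct product; for $N\ge 2$ that homomorphism is not injective). Then $\lambda(\widetilde G)\subset\widetilde H$. Let $(M,g)$ be an oriented smooth Riemannian manifold of dimension $D$, let $P_{SO}$ be its $SO(D)$-principal bundle of oriented orthonormal frames, and let a spin structure on $M$ be given, that is, a smooth $\mathrm{Spin}(D)$-principal bundle $P_{\mathrm{Spin}}\to M$ with a smooth bundle map $\lambda:P_{\mathrm{Spin}}\to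 P_{SO}$ over $\mathrm{id}_M$ such that $\lambda(pa)=\lambda(p)\lambda(a)$. Suppose that $P_{SO}$ reduces to $\widetilde H$: there are a smooth $\widetilde H$-principal bundle $P_{\widetilde H}\to M$ and a smooth $\widetilde H$-equivariant bundle map $\imath:P_{\widetilde H}\to P_{SO}$ over $\mathrm{id}_M$. Then the fibre product $$P_{\widetilde G}=\{(p,q)\in P_{\mathrm{Spin}}\times P_{\widetilde H}\mid \lambda(p)=\imath(q)\},\qquad (p,q)\,a=(pa,\,q\,\lambda(a))\quad(a\in\widetilde G),$$ is a smooth $\widetilde G$-principal bundle over $M$, and the projection $P_{\widetilde G}\to P_{\mathrm{Spin}}$, $(p,q)\mapsto p$, is a smooth $\widetilde G$-equivariant bundle map over $\mathrm{id}_M$, i.e. a reduction of $P_{\mathrm{Spin}}$ to $\widetilde G$. Moreover $(p,q)\mapsto q$ is a smooth bundle map $P_{\widetilde G}\to P_{\widetilde H}$ over $\mathrm{id}_M$ that is equivariant along $\lambda:\widetilde G\to\widetilde H$. -/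

import Mathlib

open CliffordAlgebra
open scoped Manifold ContDiff

noncomputable section

/-- The negative definite form `v ↦ -⟨v, v⟩` of `ℝⁿ`; its Clifford algebra `Cl(n)` has the relation
`v w + w v = -2 ⟨v, w⟩`. -/
abbrev stdForm (n : ℕ) : QuadraticForm ℝ (Fin n → ℝ) :=
  QuadraticMap.weightedSumSquares ℝ (fun _ : Fin n => (-1 : ℝ))

/-- The group `SO(n)`. -/
abbrev SOGroup (n : ℕ) : Type := Matrix.specialOrthogonalGroup (Fin n) ℝ

/-- The group `Spin(n)` in the Clifford algebra `Cl(n)`. -/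
abbrev SpinGroup (n : ℕ) : Type := spinGroup (stdForm n)


theorem stdForm_apply {n : ℕ} (v : Fin n → ℝ) : stdForm n v = - (v ⬝ᵥ v) := by
  simp [QuadraticMap.weightedSumSquares_apply, dotProduct]

theorem polar_stdForm {n : ℕ} (v w : Fin n → ℝ) :
    QuadraticMap.polar (stdForm n) v w = -2 * (v ⬝ᵥ w) := by
  simp only [QuadraticMap.polar, stdForm_apply, add_dotProduct, dotProduct_add]
  rw [dotProduct_comm w v]; ring

theorem clifford_ι_injective {n : ℕ} : Function.Injective (ι (stdForm n)) := by
  intro v w h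
  have h' := congrArg (CliffordAlgebra.equivExterior (stdForm n)) h
  simpa [CliffordAlgebra.equivExterior, CliffordAlgebra.changeFormEquiv, CliffordAlgebra.changeForm_ι,
    ExteriorAlgebra.ι_inj] using h'

theorem det_reflection_stdForm {n : ℕ} (a : Fin n → ℝ) (ha : a ⬝ᵥ a ≠ 0)
    (f : (Fin n → ℝ) →ₗ[ℝ] (Fin n → ℝ))
    (hf : ∀ v, f v = v - (2 * (a ⬝ᵥ v) / (a ⬝ᵥ a)) • a) : LinearMap.det f = -1 := by
  have h : LinearMap.toMatrix' f = 1 + Matrix.replicateCol Unit a *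
      Matrix.replicateRow Unit (-(2 / (a ⬝ᵥ a)) • a) := by
    ext i j
    rw [LinearMap.toMatrix'_apply, hf]
    simp [Matrix.mul_apply, Matrix.one_apply, Pi.single_apply, dotProduct]
    ring
  rw [← LinearMap.det_toMatrix', h, Matrix.det_one_add_replicateCol_mul_replicateRow,
    smul_dotProduct, smul_eq_mul]
  field_simp
  norm_num

theorem lipschitz_vector_aux {n : ℕ} (x : (CliffordAlgebra (stdForm n))ˣ)
    (hx : (x : CliffordAlgebra (stdForm n)) ∈ Set.range (ι (stdForm n))) :
    (x : CliffordAlgebra (stdForm n)) ∈ evenOdd (stdForm n) 1 ∧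
      ∃ f : (Fin n → ℝ) →ₗ[ℝ] (Fin n → ℝ), LinearMap.det f = -1 ∧
        ∀ v, ι (stdForm n) (f v) =
          involute (x : CliffordAlgebra (stdForm n)) * ι (stdForm n) v * ↑x⁻¹ := by
  obtain ⟨a, ha⟩ := hx
  refine ⟨ha ▸ ι_mem_evenOdd_one _ a, ?_⟩
  let _ := x.invertible
  let _ : Invertible (ι (stdForm n) a) := by rwa [ha]
  let _ : Invertible (stdForm n a) := invertibleOfInvertibleι (stdForm n) a
  have hQ : stdForm n a ≠ 0 := Invertible.ne_zero _
  have haa : a ⬝ᵥ a ≠ 0 := fun h => hQ (by rw [stdForm_apply, h, neg_zero])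
  let f : (Fin n → ℝ) →ₗ[ℝ] (Fin n → ℝ) :=
    LinearMap.id - (((2 / (a ⬝ᵥ a)) • dotProductBilin ℝ ℝ a).smulRight a)
  have hf : ∀ v, f v = v - (2 * (a ⬝ᵥ v) / (a ⬝ᵥ a)) • a := by
    intro v
    simp [f, dotProductBilin]
    ring_nf
  refine ⟨f, det_reflection_stdForm a haa f hf, fun v => ?_⟩
  have hinv : (↑x⁻¹ : CliffordAlgebra (stdForm n)) = ⅟(ι (stdForm n) a) := by
    exact (invOf_eq_right_inv (by rw [ha]; exact x.mul_inv)).symm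
  rw [hinv, ← ha, involute_ι, neg_mul, neg_mul, ι_mul_ι_mul_invOf_ι, ← map_neg, hf]
  congr 1
  rw [polar_stdForm, invOf_eq_inv, stdForm_apply, neg_sub]
  congr 2
  field_simp

theorem lipschitz_aux {n : ℕ} (x : (CliffordAlgebra (stdForm n))ˣ)
    (hx : x ∈ lipschitzGroup (stdForm n)) :
    ∃ k : ZMod 2, (x : CliffordAlgebra (stdForm n)) ∈ evenOdd (stdForm n) k ∧
      ∃ f : (Fin n → ℝ) →ₗ[ℝ] (Fin n → ℝ), LinearMap.det f = (if k = 0 then 1 else -1) ∧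
        ∀ v, ι (stdForm n) (f v) =
          involute (x : CliffordAlgebra (stdForm n)) * ι (stdForm n) v * ↑x⁻¹ := by
  unfold lipschitzGroup at hx
  induction hx using Subgroup.closure_induction'' with
  | mem x hx =>
    obtain ⟨h1, f, hf, h⟩ := lipschitz_vector_aux x hx
    exact ⟨1, h1, f, by simpa using hf, h⟩
  | inv_mem x hx =>
    have hx' : (↑x⁻¹ : CliffordAlgebra (stdForm n)) ∈ Set.range (ι (stdForm n)) := by
      obtain ⟨a, ha⟩ := hx
      let _ := x.invertible
      let _ : Invertible (ι (stdForm n) a) := by rwa [ha]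
      let _ : Invertible (stdForm n a) := invertibleOfInvertibleι (stdForm n) a
      refine ⟨⅟(stdForm n a) • a, ?_⟩
      rw [← invOf_ι]
      exact invOf_eq_right_inv (by rw [ha]; exact x.mul_inv)
    obtain ⟨h1, f, hf, h⟩ := lipschitz_vector_aux x⁻¹ hx'
    exact ⟨1, h1, f, by simpa using hf, h⟩
  | one => exact ⟨0, by simpa using Submodule.one_le.mp (one_le_evenOdd_zero (stdForm n)), LinearMap.id, by simp, by simp⟩
  | mul x y _ _ hx hy =>
    obtain ⟨k, hk, f, hf, h⟩ := hx
    obtain ⟨l, hl, f', hf', h'⟩ := hy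
    refine ⟨k + l, ?_, f ∘ₗ f', ?_, fun v => ?_⟩
    · rw [Units.val_mul]
      exact evenOdd_mul_le _ k l (Submodule.mul_mem_mul hk hl)
    · rw [LinearMap.det_comp, hf, hf']
      clear hk hl hf hf'
      revert k l
      have h2 : ∀ k l : ZMod 2, (k = 0 ∧ l = 0) ∨ (k = 0 ∧ l = 1) ∨ (k = 1 ∧ l = 0) ∨
        (k = 1 ∧ l = 1) := by decide
      intro k l
      have h3 : (1 + 1 : ZMod 2) = 0 := by decide
      rcases h2 k l with ⟨rfl, rfl⟩ | ⟨rfl, rfl⟩ | ⟨rfl, rfl⟩ | ⟨rfl, rfl⟩ <;> simp [h3]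
    · rw [LinearMap.comp_apply, h, h']
      simp [mul_assoc]

/-- Conjugation by a spin element is a linear map of determinant one. -/
theorem exists_spin_conj {n : ℕ} (g : SpinGroup n) :
    ∃ f : (Fin n → ℝ) →ₗ[ℝ] (Fin n → ℝ), LinearMap.det f = 1 ∧
      ∀ v, ι (stdForm n) (f v) = (g : CliffordAlgebra (stdForm n)) * ι (stdForm n) v *
        star (g : CliffordAlgebra (stdForm n)) := by
  obtain ⟨x, hx, hxg⟩ := pinGroup.mem_lipschitzGroup (spinGroup.mem_pin g.2)
  have hxg' : (x : CliffordAlgebra (stdForm n)) = g := hxg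
  obtain ⟨k, hk, f, hf, h⟩ := lipschitz_aux x hx
  have heven : (x : CliffordAlgebra (stdForm n)) ∈ evenOdd (stdForm n) 0 := by
    rw [hxg']; exact spinGroup.mem_even g.2
  have hinv : (↑x⁻¹ : CliffordAlgebra (stdForm n)) = star (g : CliffordAlgebra (stdForm n)) := by
    rw [Units.inv_eq_of_mul_eq_one_right]
    rw [hxg']; exact spinGroup.mul_star_self_of_mem g.2
  have hk0 : k = 0 := by
    by_contra hk0
    have : k = 1 := (by decide : ∀ k : ZMod 2, k ≠ 0 → k = 1) k hk0
    subst this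
    have h0 : (x : CliffordAlgebra (stdForm n)) = 0 :=
      Submodule.disjoint_def.1 (evenOdd_isCompl (stdForm n)).disjoint _ heven hk
    exact x.ne_zero h0
  refine ⟨f, by simp [hf, hk0], fun v => ?_⟩
  rw [h, hinv, hxg', spinGroup.involute_eq g.2]

/-- The linear map `v ↦ g v g⁻¹` of `ℝⁿ` for `g ∈ Spin(n)`. -/
def spinConj {n : ℕ} (g : SpinGroup n) : (Fin n → ℝ) →ₗ[ℝ] (Fin n → ℝ) :=
  (exists_spin_conj g).choose

theorem det_spinConj {n : ℕ} (g : SpinGroup n) : LinearMap.det (spinConj g) = 1 :=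
  (exists_spin_conj g).choose_spec.1

theorem ι_spinConj {n : ℕ} (g : SpinGroup n) (v : Fin n → ℝ) :
    ι (stdForm n) (spinConj g v) = (g : CliffordAlgebra (stdForm n)) * ι (stdForm n) v *
      ((g⁻¹ : SpinGroup n) : CliffordAlgebra (stdForm n)) :=
  (exists_spin_conj g).choose_spec.2 v

theorem spinConj_one {n : ℕ} : spinConj (1 : SpinGroup n) = LinearMap.id := by
  ext1 i
  apply LinearMap.ext_ring
  apply clifford_ι_injective
  simp [ι_spinConj]

theorem spinConj_mul {n : ℕ} (g h : SpinGroup n) :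
    spinConj (g * h) = spinConj g ∘ₗ spinConj h := by
  refine LinearMap.ext fun v => clifford_ι_injective ?_
  rw [LinearMap.comp_apply, ι_spinConj, ι_spinConj, ι_spinConj, mul_inv_rev]
  simp only [Submonoid.coe_mul, mul_assoc]

theorem stdForm_spinConj {n : ℕ} (g : SpinGroup n) (v : Fin n → ℝ) :
    stdForm n (spinConj g v) = stdForm n v := by
  have hg : ((g⁻¹ : SpinGroup n) : CliffordAlgebra (stdForm n)) * g = 1 :=
    congrArg Subtype.val (inv_mul_cancel g)
  have hg' : (g : CliffordAlgebra (stdForm n)) * ((g⁻¹ : SpinGroup n) : CliffordAlgebra (stdForm n)) = 1 :=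
    congrArg Subtype.val (mul_inv_cancel g)
  have h : algebraMap ℝ (CliffordAlgebra (stdForm n)) (stdForm n (spinConj g v)) =
      algebraMap ℝ (CliffordAlgebra (stdForm n)) (stdForm n v) := by
    rw [← ι_sq_scalar, ι_spinConj]
    calc _ = (g : CliffordAlgebra (stdForm n)) * ι (stdForm n) v *
        (((g⁻¹ : SpinGroup n) : CliffordAlgebra (stdForm n)) * g) * ι (stdForm n) v *
          ((g⁻¹ : SpinGroup n) : CliffordAlgebra (stdForm n)) := by simp only [mul_assoc]
      _ = (g : CliffordAlgebra (stdForm n)) * (ι (stdForm n) v * ι (stdForm n) v) *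
          ((g⁻¹ : SpinGroup n) : CliffordAlgebra (stdForm n)) := by
            rw [hg]; simp only [mul_assoc, one_mul]
      _ = _ := by rw [ι_sq_scalar, ← Algebra.commutes, mul_assoc, hg', mul_one]
  exact FaithfulSMul.algebraMap_injective _ _ h

theorem spinConj_dotProduct {n : ℕ} (g : SpinGroup n) (v w : Fin n → ℝ) :
    spinConj g v ⬝ᵥ spinConj g w = v ⬝ᵥ w := by
  have h : QuadraticMap.polar (stdForm n) (spinConj g v) (spinConj g w) =
      QuadraticMap.polar (stdForm n) v w := by
    simp only [QuadraticMap.polar, ← map_add, stdForm_spinConj]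
  simpa [polar_stdForm] using h

/-- The two-fold covering homomorphism `Spin(n) → SO(n)`, `g ↦ (v ↦ g v g⁻¹)`. -/
def spinCover (n : ℕ) : SpinGroup n →* SOGroup n where
  toFun g := ⟨LinearMap.toMatrix' (spinConj g), by
    rw [Matrix.mem_specialOrthogonalGroup_iff, Matrix.mem_orthogonalGroup_iff']
    refine ⟨?_, by rw [LinearMap.det_toMatrix', det_spinConj]⟩
    ext i j
    have h := spinConj_dotProduct g (Pi.single i 1) (Pi.single j 1)
    simpa [Matrix.mul_apply, LinearMap.toMatrix'_apply, dotProduct, Matrix.one_apply,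
      Pi.single_apply, eq_comm] using h⟩
  map_one' := Subtype.ext (by simp [spinConj_one])
  map_mul' g h := Subtype.ext (by simp [spinConj_mul, LinearMap.toMatrix'_comp])

section blocks

variable {N : ℕ} (D : Fin N → ℕ)

/-- The inclusion of the `i`-th factor into `ℝ^{D_1} ⊕ ⋯ ⊕ ℝ^{D_N} = ℝ^{D_1 + ⋯ + D_N}`, where the
coordinates of the summands are put one after the other. -/
def blockInclusion (i : Fin N) : (Fin (D i) → ℝ) →ₗ[ℝ] (Fin (∑ j, D j) → ℝ) where
  toFun v k := (Pi.single i v : ∀ j, Fin (D j) → ℝ)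
    (finSigmaFinEquiv.symm k).1 (finSigmaFinEquiv.symm k).2
  map_add' v w := by ext k; simp [Pi.single_add]
  map_smul' c v := by ext k; simp [Pi.single_smul]

theorem blockInclusion_apply (i : Fin N) (v : Fin (D i) → ℝ) (j : Fin N) (b : Fin (D j)) :
    blockInclusion D i v (finSigmaFinEquiv ⟨j, b⟩) = (Pi.single i v : ∀ j, Fin (D j) → ℝ) j b :=
  congrArg (fun s : (Σ j, Fin (D j)) => (Pi.single i v : ∀ j, Fin (D j) → ℝ) s.1 s.2)
    (finSigmaFinEquiv.symm_apply_apply ⟨j, b⟩)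

theorem blockInclusion_dotProduct_self (i : Fin N) (v w : Fin (D i) → ℝ) :
    blockInclusion D i v ⬝ᵥ blockInclusion D i w = v ⬝ᵥ w := by
  simp only [dotProduct, blockInclusion, LinearMap.coe_mk, AddHom.coe_mk]
  rw [Equiv.sum_comp finSigmaFinEquiv.symm (fun s : (Σ j, Fin (D j)) =>
    (Pi.single i v : ∀ j, Fin (D j) → ℝ) s.1 s.2 * (Pi.single i w : ∀ j, Fin (D j) → ℝ) s.1 s.2),
    Fintype.sum_sigma, Finset.sum_eq_single i]
  · simp
  · intro j _ hj; simp [Pi.single_eq_of_ne hj]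
  · simp

theorem blockInclusion_dotProduct_ne {i j : Fin N} (hij : i ≠ j) (v : Fin (D i) → ℝ)
    (w : Fin (D j) → ℝ) : blockInclusion D i v ⬝ᵥ blockInclusion D j w = 0 := by
  simp only [dotProduct, blockInclusion, LinearMap.coe_mk, AddHom.coe_mk]
  refine Finset.sum_eq_zero fun k _ => ?_
  by_cases h : (finSigmaFinEquiv.symm k).1 = i
  · rw [Pi.single_eq_of_ne (i := j) (fun h' => hij (h.symm.trans h'))]; simp
  · rw [Pi.single_eq_of_ne (i := i) h]; simp

/-- The inclusion of the `i`-th summand as an isometry of quadratic forms. -/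
def blockIsometry (i : Fin N) : stdForm (D i) →qᵢ stdForm (∑ j, D j) where
  toLinearMap := blockInclusion D i
  map_app' v := by
    change stdForm _ (blockInclusion D i v) = _
    rw [stdForm_apply, stdForm_apply, blockInclusion_dotProduct_self]

theorem blockIsometry_isOrtho {i j : Fin N} (hij : i ≠ j) (v : Fin (D i) → ℝ)
    (w : Fin (D j) → ℝ) :
    (stdForm (∑ k, D k)).IsOrtho (blockIsometry D i v) (blockIsometry D j w) := by
  have h : QuadraticMap.polar (stdForm (∑ k, D k)) (blockInclusion D i v)
      (blockInclusion D j w) = 0 := by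
    rw [polar_stdForm, blockInclusion_dotProduct_ne D hij, mul_zero]
  rw [QuadraticMap.polar, sub_sub, sub_eq_zero] at h
  exact h

theorem clifford_map_star {m n : ℕ} (f : stdForm m →qᵢ stdForm n) (x : CliffordAlgebra (stdForm m)) :
    CliffordAlgebra.map f (star x) = star (CliffordAlgebra.map f x) := by
  induction x using CliffordAlgebra.induction with
  | algebraMap r => simp [star_algebraMap]
  | ι v => simp [star_ι]
  | mul a b ha hb => simp [ha, hb]
  | add a b ha hb => simp [ha, hb]

theorem clifford_map_mem_evenOdd {m n : ℕ} (f : stdForm m →qᵢ stdForm n) (k : ZMod 2)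
    {x : CliffordAlgebra (stdForm m)} (hx : x ∈ evenOdd (stdForm m) k) :
    CliffordAlgebra.map f x ∈ evenOdd (stdForm n) k := by
  have h : (evenOdd (stdForm m) k).map (CliffordAlgebra.map f).toLinearMap ≤
      evenOdd (stdForm n) k := by
    unfold evenOdd
    rw [Submodule.map_iSup]
    refine iSup_mono fun i => ?_
    rw [Submodule.map_pow, ι_range_map_map]
    exact pow_le_pow_left' (by rintro _ ⟨a, _, rfl⟩; exact ⟨_, rfl⟩) _
  exact h (Submodule.mem_map_of_mem hx)

theorem clifford_map_mem_spinGroup {m n : ℕ} (f : stdForm m →qᵢ stdForm n)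
    {x : CliffordAlgebra (stdForm m)} (hx : x ∈ spinGroup (stdForm m)) :
    CliffordAlgebra.map f x ∈ spinGroup (stdForm n) := by
  refine spinGroup.mem_iff.2 ⟨pinGroup.mem_iff.2 ⟨?_, ?_⟩,
    clifford_map_mem_evenOdd f 0 (spinGroup.mem_even hx)⟩
  · obtain ⟨y, hy, rfl⟩ := pinGroup.mem_lipschitzGroup (spinGroup.mem_pin hx)
    refine ⟨Units.map (CliffordAlgebra.map f : _ →* CliffordAlgebra (stdForm n)) y, ?_, rfl⟩
    have h : lipschitzGroup (stdForm m) ≤ (lipschitzGroup (stdForm n)).comap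
        (Units.map (CliffordAlgebra.map f : _ →* CliffordAlgebra (stdForm n))) := by
      refine (Subgroup.closure_le _).2 ?_
      rintro u ⟨a, ha⟩
      refine Subgroup.subset_closure ⟨f a, ?_⟩
      rw [← map_apply_ι, ha]; rfl
    exact h hy
  · rw [Unitary.mem_iff, ← clifford_map_star, ← map_mul, ← map_mul,
      spinGroup.star_mul_self_of_mem hx, spinGroup.mul_star_self_of_mem hx]
    simp

/-- The inclusion `Spin(D_i) → Spin(D_1 + ⋯ + D_N)` of the `i`-th factor. -/
def spinInclusion (i : Fin N) : SpinGroup (D i) →* SpinGroup (∑ j, D j) where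
  toFun x := ⟨CliffordAlgebra.map (blockIsometry D i) x, clifford_map_mem_spinGroup _ x.2⟩
  map_one' := Subtype.ext (by simp)
  map_mul' x y := Subtype.ext (by simp)

theorem spinInclusion_commute : Pairwise fun i j : Fin N =>
    ∀ (x : SpinGroup (D i)) (y : SpinGroup (D j)),
      Commute (spinInclusion D i x) (spinInclusion D j y) := fun _ _ hij x y =>
  Subtype.ext (commute_map_mul_map_of_isOrtho_of_mem_evenOdd_zero_left _ _
    (blockIsometry_isOrtho D hij) _ _ (spinGroup.mem_even x.2) (spinGroup.mem_even y.2))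

/-- The multiplication homomorphism
`Spin(D_1) × ⋯ × Spin(D_N) → Spin(D_1 + ⋯ + D_N)`, `(x_1, …, x_N) ↦ x_1 ⋯ x_N`. -/
def spinProductHom : (∀ i, SpinGroup (D i)) →* SpinGroup (∑ i, D i) :=
  MonoidHom.noncommPiCoprod (spinInclusion D) (spinInclusion_commute D)

/-- The group `Spin(D_1) × ⋯ × Spin(D_N)` as a subgroup of `Spin(D_1 + ⋯ + D_N)`: all products
`x_1 ⋯ x_N` with `x_i ∈ Spin(D_i)`, that is, all `x_1 ⊗ ⋯ ⊗ x_N` in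
`Cl(D_1) ⊗ ⋯ ⊗ Cl(D_N) = Cl(D_1 + ⋯ + D_N)`. -/
def spinProduct : Subgroup (SpinGroup (∑ i, D i)) := (spinProductHom D).range

theorem det_blockDiagonal_prime (A : ∀ i, Matrix (Fin (D i)) (Fin (D i)) ℝ) :
    (Matrix.blockDiagonal' A).det = ∏ i, (A i).det := by
  rw [(Matrix.blockTriangular_blockDiagonal' A).det_fintype]
  refine Finset.prod_congr rfl fun i _ => ?_
  let e : {s : (Σ j, Fin (D j)) // s.1 = i} ≃ Fin (D i) := Equiv.sigmaSubtype i
  rw [← Matrix.det_submatrix_equiv_self e (A i)]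
  congr 1
  ext ⟨⟨j, a⟩, ha⟩ ⟨⟨k, b⟩, hb⟩
  obtain rfl : j = i := ha
  obtain rfl : k = j := hb
  simp [Matrix.toSquareBlock_def, Matrix.blockDiagonal'_apply_eq, e, Equiv.sigmaSubtype]

/-- The block diagonal homomorphism `SO(D_1) × ⋯ × SO(D_N) → SO(D_1 + ⋯ + D_N)`. -/
def soProductHom : (∀ i, SOGroup (D i)) →* SOGroup (∑ i, D i) where
  toFun A := ⟨Matrix.reindex finSigmaFinEquiv finSigmaFinEquiv
      (Matrix.blockDiagonal' fun i => (A i : Matrix (Fin (D i)) (Fin (D i)) ℝ)), by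
    rw [Matrix.mem_specialOrthogonalGroup_iff, Matrix.mem_orthogonalGroup_iff]
    constructor
    · have h : ∀ i, (A i : Matrix (Fin (D i)) (Fin (D i)) ℝ) * (A i : Matrix _ _ ℝ).transpose = 1 :=
        fun i => (Matrix.mem_orthogonalGroup_iff _ _).1 (A i).2.1
      simp only [Matrix.transpose_reindex, Matrix.blockDiagonal'_transpose]
      rw [← Matrix.coe_reindexAlgEquiv ℝ ℝ, ← map_mul,
        ← Matrix.blockDiagonal'_mul]
      simp only [h]
      rw [show (fun i => (1 : Matrix (Fin (D i)) (Fin (D i)) ℝ)) = 1 from rfl,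
        Matrix.blockDiagonal'_one, map_one]
    · have h : ∀ i, (A i : Matrix (Fin (D i)) (Fin (D i)) ℝ).det = 1 := fun i => (A i).2.2
      rw [Matrix.det_reindex_self, det_blockDiagonal_prime]
      simp [h]⟩
  map_one' := Subtype.ext (by
    change Matrix.reindex _ _ (Matrix.blockDiagonal'
      (1 : ∀ i, Matrix (Fin (D i)) (Fin (D i)) ℝ)) = 1
    rw [Matrix.blockDiagonal'_one, ← Matrix.coe_reindexAlgEquiv ℝ ℝ, map_one])
  map_mul' A B := Subtype.ext (by
    change Matrix.reindex _ _ (Matrix.blockDiagonal' fun i =>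
      (A i : Matrix (Fin (D i)) (Fin (D i)) ℝ) * (B i : Matrix (Fin (D i)) (Fin (D i)) ℝ)) =
      Matrix.reindex _ _ _ * Matrix.reindex _ _ _
    rw [Matrix.blockDiagonal'_mul, ← Matrix.coe_reindexAlgEquiv ℝ ℝ, map_mul])

/-- The group `SO(D_1) × ⋯ × SO(D_N)` as the subgroup of block diagonal matrices of
`SO(D_1 + ⋯ + D_N)`. -/
def soProduct : Subgroup (SOGroup (∑ i, D i)) := (soProductHom D).range

theorem single_eq_blockInclusion (i : Fin N) (a : Fin (D i)) :
    (Pi.single (finSigmaFinEquiv ⟨i, a⟩) 1 : Fin (∑ j, D j) → ℝ) =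
      blockInclusion D i (Pi.single a 1) := by
  ext k
  obtain ⟨⟨j, b⟩, rfl⟩ := finSigmaFinEquiv.surjective k
  rw [blockInclusion_apply]
  by_cases h : j = i
  · subst h
    simp [Pi.single_apply]
  · rw [Pi.single_eq_of_ne (i := i) h, Pi.single_eq_of_ne]
    · rfl
    · intro h'
      exact h (congrArg Sigma.fst (finSigmaFinEquiv.injective h'))

theorem linearMap_ext_blockInclusion {f g : (Fin (∑ j, D j) → ℝ) →ₗ[ℝ] (Fin (∑ j, D j) → ℝ)}
    (h : ∀ i v, f (blockInclusion D i v) = g (blockInclusion D i v)) : f = g := by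
  refine LinearMap.pi_ext' fun k => LinearMap.ext_ring ?_
  obtain ⟨⟨j, b⟩, rfl⟩ := finSigmaFinEquiv.surjective k
  simpa [single_eq_blockInclusion] using h j (Pi.single b 1)

theorem soProductHom_mulVec (A : ∀ i, SOGroup (D i)) (i : Fin N) (v : Fin (D i) → ℝ) :
    Matrix.mulVec (soProductHom D A : Matrix (Fin (∑ j, D j)) (Fin (∑ j, D j)) ℝ)
      (blockInclusion D i v) =
      blockInclusion D i (Matrix.mulVec (A i : Matrix (Fin (D i)) (Fin (D i)) ℝ) v) := by
  ext k
  obtain ⟨⟨j, b⟩, rfl⟩ := finSigmaFinEquiv.surjective k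
  rw [blockInclusion_apply]
  simp only [Matrix.mulVec, dotProduct, soProductHom, blockInclusion, LinearMap.coe_mk,
    AddHom.coe_mk, MonoidHom.coe_mk, OneHom.coe_mk, Matrix.reindex_apply, Matrix.submatrix_apply,
    Equiv.symm_apply_apply]
  rw [Equiv.sum_comp finSigmaFinEquiv.symm (fun s : (Σ j, Fin (D j)) =>
    Matrix.blockDiagonal' (fun i => (A i : Matrix (Fin (D i)) (Fin (D i)) ℝ)) ⟨j, b⟩ s *
      (Pi.single i v : ∀ j, Fin (D j) → ℝ) s.1 s.2), Fintype.sum_sigma, Finset.sum_eq_single i]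
  · by_cases h : j = i
    · subst h
      simp [Matrix.blockDiagonal'_apply_eq, Matrix.mulVec, dotProduct]
    · simp [Matrix.blockDiagonal'_apply_ne _ _ _ h, Pi.single_eq_of_ne h]
  · intro l _ hl
    simp [Pi.single_eq_of_ne hl]
  · simp

theorem spinConj_spinInclusion_same (i : Fin N) (x : SpinGroup (D i)) (v : Fin (D i) → ℝ) :
    spinConj (spinInclusion D i x) (blockInclusion D i v) = blockInclusion D i (spinConj x v) := by
  apply clifford_ι_injective
  have h1 : ∀ w : Fin (D i) → ℝ, ι (stdForm (∑ j, D j)) (blockInclusion D i w) =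
      CliffordAlgebra.map (blockIsometry D i) (ι (stdForm (D i)) w) :=
    fun w => (map_apply_ι (blockIsometry D i) w).symm
  rw [ι_spinConj, h1, h1, ι_spinConj, map_mul, map_mul, ← map_inv]
  rfl

theorem spinConj_spinInclusion_ne {i j : Fin N} (hij : i ≠ j) (x : SpinGroup (D i))
    (v : Fin (D j) → ℝ) :
    spinConj (spinInclusion D i x) (blockInclusion D j v) = blockInclusion D j v := by
  apply clifford_ι_injective
  have h1 : ι (stdForm (∑ j, D j)) (blockInclusion D j v) =
      CliffordAlgebra.map (blockIsometry D j) (ι (stdForm (D j)) v) :=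
    (map_apply_ι (blockIsometry D j) v).symm
  have h2 := commute_map_mul_map_of_isOrtho_of_mem_evenOdd_zero_left _ _
    (blockIsometry_isOrtho D hij) _ _ (spinGroup.mem_even x.2) (ι_mem_evenOdd_one _ v)
  have h3 : ((spinInclusion D i x : SpinGroup (∑ j, D j)) : CliffordAlgebra (stdForm (∑ j, D j))) *
      (((spinInclusion D i x)⁻¹ : SpinGroup (∑ j, D j)) :
        CliffordAlgebra (stdForm (∑ j, D j))) = 1 :=
    congrArg Subtype.val (mul_inv_cancel (spinInclusion D i x))
  have h4 : ((spinInclusion D i x : SpinGroup (∑ j, D j)) : CliffordAlgebra (stdForm (∑ j, D j))) =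
    CliffordAlgebra.map (blockIsometry D i) (x : CliffordAlgebra (stdForm (D i))) := rfl
  rw [ι_spinConj, h1, h4, h2.eq, mul_assoc, ← h4, h3, mul_one]

theorem spinCover_spinInclusion (i : Fin N) (x : SpinGroup (D i)) :
    spinCover _ (spinInclusion D i x) =
      soProductHom D (Pi.mulSingle i (spinCover (D i) x)) := by
  apply Subtype.ext
  apply Matrix.toLin'.injective
  refine linearMap_ext_blockInclusion D fun j v => ?_
  rw [Matrix.toLin'_apply, Matrix.toLin'_apply, soProductHom_mulVec]
  have h1 : ∀ {n : ℕ} (g : SpinGroup n) (w : Fin n → ℝ),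
      Matrix.mulVec (spinCover n g : Matrix (Fin n) (Fin n) ℝ) w = spinConj g w :=
    fun g w => LinearMap.toMatrix'_mulVec _ _
  rw [h1]
  by_cases hij : i = j
  · subst hij
    rw [spinConj_spinInclusion_same, Pi.mulSingle_eq_same, h1]
  · rw [spinConj_spinInclusion_ne D hij, Pi.mulSingle_eq_of_ne (Ne.symm hij)]
    simp

theorem spinCover_spinProductHom (x : ∀ i, SpinGroup (D i)) :
    spinCover _ (spinProductHom D x) = soProductHom D (fun i => spinCover (D i) (x i)) := by
  let F : (∀ i, SpinGroup (D i)) →* (∀ i, SOGroup (D i)) :=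
    { toFun := fun x i => spinCover (D i) (x i)
      map_one' := by ext1 i; simp
      map_mul' := fun x y => by ext1 i; simp }
  have h : (spinCover _).comp (spinProductHom D) = (soProductHom D).comp F := by
    refine MonoidHom.pi_ext fun i y => ?_
    simp only [MonoidHom.comp_apply, spinProductHom,
      MonoidHom.noncommPiCoprod_mulSingle]
    rw [spinCover_spinInclusion]
    congr 1
    ext1 j
    by_cases hij : j = i
    · subst hij; simp [F]
    · simp [F, Pi.mulSingle_eq_of_ne hij]
  exact DFunLike.congr_fun h x

/-- The restriction `Spin(D_1) ⋯ Spin(D_N) → SO(D_1) × ⋯ × SO(D_N)` of the covering. -/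
def spinProductCover : spinProduct D →* soProduct D :=
  ((spinCover _).comp (spinProduct D).subtype).codRestrict (soProduct D) (by
    rintro ⟨_, x, rfl⟩
    exact ⟨_, (spinCover_spinProductHom D x).symm⟩)

end blocks

section bundles

/-- A family of real functions on a group that determines which maps into it are smooth. -/
class SmoothCoordinates (G : Type*) where
  coordinates : Set (G → ℝ)

/-- The coordinates of `SO(n)` are the restrictions of the linear functionals of the matrix algebra:
`SO(n)` is an embedded submanifold of it, so these functions detect smoothness. -/
instance SOGroup.smoothCoordinates (n : ℕ) : SmoothCoordinates (SOGroup n) where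
  coordinates := {c | ∃ φ : Matrix (Fin n) (Fin n) ℝ →ₗ[ℝ] ℝ,
    c = fun g : SOGroup n => φ (g : Matrix (Fin n) (Fin n) ℝ)}

/-- The coordinates of `Spin(n)` are the restrictions of the linear functionals of `Cl(n)`:
`Spin(n)` is an embedded submanifold of this finite-dimensional algebra. -/
instance SpinGroup.smoothCoordinates (n : ℕ) : SmoothCoordinates (SpinGroup n) where
  coordinates := {c | ∃ φ : CliffordAlgebra (stdForm n) →ₗ[ℝ] ℝ,
    c = fun g : SpinGroup n => φ (g : CliffordAlgebra (stdForm n))}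

/-- A (closed, hence embedded) subgroup inherits the coordinates of the group. -/
instance Subgroup.smoothCoordinates {G : Type*} [Group G] [SmoothCoordinates G]
    (K : Subgroup G) : SmoothCoordinates K where
  coordinates := {c | ∃ c' ∈ SmoothCoordinates.coordinates (G := G), c = fun g : K => c' (g : G)}

variable {n : ℕ} {M : Type*} [TopologicalSpace M] [ChartedSpace (EuclideanSpace ℝ (Fin n)) M]

variable (n) in
/-- Smoothness on the set `U` of a map from an `n`-manifold to a group with coordinates. -/
def SmoothIntoGroup {G : Type*} [SmoothCoordinates G] (h : M → G) (U : Set M) : Prop :=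
  ∀ c ∈ SmoothCoordinates.coordinates (G := G),
    ContMDiffOn (𝓡 n) 𝓘(ℝ, ℝ) ∞ (fun x => c (h x)) U

/-- The data of a smooth principal bundle with total space `P`: the projection, the right action of
the structure group, and the smooth local sections `(U, s)`, where only the values of `s` on `U`
matter. The smooth structure of `P` is recorded by its smooth local sections: it is the one for
which the local trivializations `U × G → P`, `(x, a) ↦ s x · a`, are diffeomorphisms onto the
preimage of `U`. -/
structure PrincipalBundleData (M G P : Type*) where
  proj : P → M
  act : P → G → P
  smoothSections : Set (Set M × (M → P))

variable (n) in
/-- The data form a smooth principal `G`-bundle over the `n`-manifold `M`. -/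
structure IsPrincipalBundle {G P : Type*} [Group G] [SmoothCoordinates G]
    (B : PrincipalBundleData M G P) : Prop where
  act_one : ∀ p, B.act p 1 = p
  act_mul : ∀ p a b, B.act p (a * b) = B.act (B.act p a) b
  proj_act : ∀ p a, B.proj (B.act p a) = B.proj p
  /-- The action is free, and transitive on the fibres. -/
  existsUnique_act : ∀ p q, B.proj p = B.proj q → ∃! a, B.act p a = q
  isOpen : ∀ σ ∈ B.smoothSections, IsOpen σ.1
  proj_section : ∀ σ ∈ B.smoothSections, ∀ x ∈ σ.1, B.proj (σ.2 x) = x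
  /-- There are smooth sections around every point. -/
  exists_section : ∀ x, ∃ σ ∈ B.smoothSections, x ∈ σ.1
  /-- Any two smooth sections differ by a smooth map to the structure group, and every section that
  differs from all smooth sections by such maps is smooth. -/
  mem_smoothSections_iff : ∀ (V : Set M) (t : M → P), IsOpen V → (∀ x ∈ V, B.proj (t x) = x) →
    ((V, t) ∈ B.smoothSections ↔ ∀ σ ∈ B.smoothSections, ∃ h : M → G,
      SmoothIntoGroup n h (σ.1 ∩ V) ∧ ∀ x ∈ σ.1 ∩ V, t x = B.act (σ.2 x) (h x))

/-- A smooth bundle map over the identity of `M` that is equivariant along `φ : G → H`. An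
equivariant bundle map is smooth if and only if it maps smooth local sections to such. -/
structure IsPrincipalMorphism {M G H P Q : Type*} [Group G] [Group H] (φ : G →* H)
    (B : PrincipalBundleData M G P) (C : PrincipalBundleData M H Q) (f : P → Q) : Prop where
  proj_map : ∀ p, C.proj (f p) = B.proj p
  map_act : ∀ p a, f (B.act p a) = C.act (f p) (φ a)
  map_section : ∀ σ ∈ B.smoothSections, (σ.1, fun x => f (σ.2 x)) ∈ C.smoothSections

variable (n) in
/-- `f : Q → P` is a reduction of the `G`-bundle `P` to the subgroup `K`: `Q` is a smooth principal
`K`-bundle and `f` a smooth `K`-equivariant bundle map over the identity of the base. -/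
structure IsReduction {G P Q : Type*} [Group G] [SmoothCoordinates G] (K : Subgroup G)
    (C : PrincipalBundleData M K Q) (B : PrincipalBundleData M G P) (f : Q → P) : Prop where
  isPrincipalBundle : IsPrincipalBundle n C
  isPrincipalMorphism : IsPrincipalMorphism K.subtype C B f

/-- The fibre product `{(p, q) | lam p = i q}` of a `G`-bundle and a `K`-bundle over an `H`-bundle,
with the action `(p, q) · a = (p · a, q · ψ a)` of a subgroup `L` of `G` on which `φ : G → H`
restricts to `ψ : L → K`. A section is smooth if and only if both of its components are. -/
def fibreProduct {M G H P Q R : Type*} [Group G] [Group H] {φ : G →* H} {K : Subgroup H}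
    {L : Subgroup G} (ψ : L →* K) (hψ : ∀ a : L, (ψ a : H) = φ a)
    {B : PrincipalBundleData M G P} {C : PrincipalBundleData M K Q}
    {F : PrincipalBundleData M H R} {lam : P → R} {i : Q → R}
    (hlam : IsPrincipalMorphism φ B F lam) (hi : IsPrincipalMorphism K.subtype C F i) :
    PrincipalBundleData M L {z : P × Q // lam z.1 = i z.2} where
  proj z := B.proj z.1.1
  act z a := ⟨(B.act z.1.1 a, C.act z.1.2 (ψ a)), by
    rw [hlam.map_act, hi.map_act, z.2, Subgroup.coe_subtype, hψ]⟩
  smoothSections := {σ | (σ.1, fun x => (σ.2 x).1.1) ∈ B.smoothSections ∧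
    (σ.1, fun x => (σ.2 x).1.2) ∈ C.smoothSections}

end bundles

section frames

/-- The tuple `e` is a basis with the orientation `o`. -/
def IsPositiveBasis {n : ℕ} {V : Type*} [AddCommGroup V] [Module ℝ V]
    (o : Orientation ℝ V (Fin n)) (e : Fin n → V) : Prop :=
  ∃ b : Module.Basis (Fin n) ℝ V, ⇑b = e ∧ b.orientation = o

variable (n : ℕ) (M : Type*) [TopologicalSpace M] [ChartedSpace (EuclideanSpace ℝ (Fin n)) M]
  [IsManifold (𝓡 n) ∞ M]

/-- A smooth Riemannian metric on the `n`-manifold `M`. -/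
abbrev RiemannianMetricOn : Type _ :=
  Bundle.ContMDiffRiemannianMetric (𝓡 n) ∞ (EuclideanSpace ℝ (Fin n))
    (fun x : M => TangentSpace (𝓡 n) x)

/-- An orientation of the `n`-manifold `M`: orientations of the tangent spaces that are given by a
smooth local frame around every point. -/
structure ManifoldOrientation where
  orientationAt : ∀ x : M, Orientation ℝ (TangentSpace (𝓡 n) x) (Fin n)
  exists_frame : ∀ x : M, ∃ U : Set M, IsOpen U ∧ x ∈ U ∧
    ∃ e : Fin n → ∀ y : M, TangentSpace (𝓡 n) y,
      (∀ i, ContMDiffOn (𝓡 n) (𝓡 n).tangent ∞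
        (fun y => (⟨y, e i y⟩ : TangentBundle (𝓡 n) M)) U) ∧
      ∀ y ∈ U, IsPositiveBasis (orientationAt y) (fun i => e i y)

variable {n M}

/-- `e` is an oriented orthonormal frame of the tangent space at `x`. -/
structure IsOrientedOrthonormal (g : RiemannianMetricOn n M) (o : ManifoldOrientation n M) (x : M)
    (e : Fin n → TangentSpace (𝓡 n) x) : Prop where
  orthonormal : ∀ i j, g.inner x (e i) (e j) = if i = j then 1 else 0
  positive : IsPositiveBasis (o.orientationAt x) e

/-- The total space of the bundle of oriented orthonormal frames of `(M, g)`. -/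
def OrthonormalFrames (g : RiemannianMetricOn n M) (o : ManifoldOrientation n M) : Type _ :=
  Σ x : M, {e : Fin n → TangentSpace (𝓡 n) x // IsOrientedOrthonormal g o x e}

theorem IsPositiveBasis.mul {V : Type*} [AddCommGroup V] [Module ℝ V]
    {o : Orientation ℝ V (Fin n)} {e : Fin n → V} (he : IsPositiveBasis o e) (A : SOGroup n) :
    IsPositiveBasis o (fun j => ∑ i, (A : Matrix (Fin n) (Fin n) ℝ) i j • e i) := by
  obtain ⟨b, rfl, hb⟩ := he
  have _ : FiniteDimensional ℝ V := b.finiteDimensional_of_finite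
  have hdet : (A : Matrix (Fin n) (Fin n) ℝ).det = 1 := A.2.2
  have hdet' : LinearMap.det (Matrix.toLin b b (A : Matrix (Fin n) (Fin n) ℝ)) = 1 := by
    rw [LinearMap.det_toLin, hdet]
  let f : V ≃ₗ[ℝ] V := LinearMap.equivOfDetNeZero
    (Matrix.toLin b b (A : Matrix (Fin n) (Fin n) ℝ)) (by rw [hdet']; exact one_ne_zero)
  have hf : (f : V →ₗ[ℝ] V) = Matrix.toLin b b (A : Matrix (Fin n) (Fin n) ℝ) := rfl
  refine ⟨b.map f, ?_, ?_⟩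
  · ext j
    rw [Module.Basis.map_apply]
    exact Matrix.toLin_self b b (A : Matrix (Fin n) (Fin n) ℝ) j
  · rw [← hb, b.orientation_comp_linearEquiv_eq_iff_det_pos, hf, hdet']
    exact one_pos

theorem IsOrientedOrthonormal.mul {g : RiemannianMetricOn n M} {o : ManifoldOrientation n M}
    {x : M} {e : Fin n → TangentSpace (𝓡 n) x} (he : IsOrientedOrthonormal g o x e)
    (A : SOGroup n) : IsOrientedOrthonormal g o x
      (fun j => ∑ i, (A : Matrix (Fin n) (Fin n) ℝ) i j • e i) where
  positive := he.positive.mul A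
  orthonormal j k := by
    have hA : (A : Matrix (Fin n) (Fin n) ℝ).transpose * (A : Matrix (Fin n) (Fin n) ℝ) = 1 :=
      (Matrix.mem_orthogonalGroup_iff' _ _).1 A.2.1
    have h := congrFun (congrFun hA j) k
    rw [Matrix.mul_apply, Matrix.one_apply] at h
    rw [← h]
    simp [he.orthonormal, mul_comm]

/-- The bundle `P_SO` of oriented orthonormal frames of `(M, g)` with the right action
`(e · A)_j = ∑ i, A_ij e_i` of `SO(n)`; the smooth sections are the smooth frames. -/
def frameBundle (g : RiemannianMetricOn n M) (o : ManifoldOrientation n M) :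
    PrincipalBundleData M (SOGroup n) (OrthonormalFrames g o) where
  proj p := p.1
  act p A := ⟨p.1, ⟨_, p.2.2.mul A⟩⟩
  smoothSections := {σ | IsOpen σ.1 ∧ (∀ x ∈ σ.1, (σ.2 x).1 = x) ∧
    ∀ i, ContMDiffOn (𝓡 n) (𝓡 n).tangent ∞
      (fun x => (⟨(σ.2 x).1, (σ.2 x).2.1 i⟩ : TangentBundle (𝓡 n) M)) σ.1}

/-- A spin structure on the oriented Riemannian manifold `(M, g)`: a smooth principal
`Spin(n)`-bundle with a smooth bundle map `lam` to the bundle of oriented orthonormal frames that is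
equivariant along the covering `Spin(n) → SO(n)`. -/
structure IsSpinStructure (g : RiemannianMetricOn n M) (o : ManifoldOrientation n M) {P : Type*}
    (B : PrincipalBundleData M (SpinGroup n) P) (lam : P → OrthonormalFrames g o) : Prop where
  isPrincipalBundle : IsPrincipalBundle n B
  isPrincipalMorphism : IsPrincipalMorphism (spinCover n) B (frameBundle g o) lam

end frames

end

/-
The kernel `{1, -1}` of `λ` lies in `G̃`, and `λ` maps `G̃` onto `H̃`, so `G̃ = λ⁻¹(H̃)`; hence `G̃`
acts simply transitively on the fibres of the fibre product. Moreover smooth maps to `SO(n)` lift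
locally to `Spin(n)`: a rotation near the identity is factored into rotations that move the basis
vectors to their images one after the other, and a unit vector `u` is moved to a unit vector
`v ≠ -u` by the product of the unit vectors along `u + v` and `u`, which depends smoothly on `v` and
fixes all vectors orthogonal to `u` and `v`. The images in `P_SO` of local sections `σ` of `P_Spin`
and `τ` of `P_H̃` differ by a smooth map to `SO(n)`, and correcting `σ` by a local lift of it gives
a smooth local section of the fibre product.
-/

noncomputable section

open Matrix

section cliffordAlgebra

variable {R M : Type*} [CommRing R] [AddCommGroup M] [Module R M] {Q : QuadraticForm R M}

theorem toSubmodule_adjoin_ι_image_insert (w : M) (s : Set M) :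
    (Algebra.adjoin R (ι Q '' insert w s)).toSubmodule =
      (Algebra.adjoin R (ι Q '' s)).toSubmodule ⊔
        (Algebra.adjoin R (ι Q '' s)).toSubmodule.map (LinearMap.mulLeft R (ι Q w)) := by
  set S := Algebra.adjoin R (ι Q '' s)
  set T := S.toSubmodule ⊔ S.toSubmodule.map (LinearMap.mulLeft R (ι Q w))
  have hι {v : M} (hv : v ∈ s) : ι Q v ∈ S := Algebra.subset_adjoin (Set.mem_image_of_mem _ hv)
  have hT {a b : CliffordAlgebra Q} (ha : a ∈ S) (hb : b ∈ S) : a + ι Q w * b ∈ T :=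
    Submodule.add_mem_sup ha (Submodule.mem_map_of_mem (f := LinearMap.mulLeft R (ι Q w)) hb)
  apply le_antisymm
  · have mul_mem_T {x : CliffordAlgebra Q} (hx : x ∈ Algebra.adjoin R (ι Q '' insert w s)) :
        ∀ y ∈ T, x * y ∈ T := by
      induction hx using Algebra.adjoin_induction with
      | algebraMap r =>
        intro y hy
        rw [← Algebra.smul_def]
        exact T.smul_mem r hy
      | add x x' _ _ hx hx' =>
        intro y hy
        rw [add_mul]
        exact add_mem (hx y hy) (hx' y hy)
      | mul x x' _ _ hx hx' =>
        intro y hy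
        rw [mul_assoc]
        exact hx _ (hx' y hy)
      | mem x hx =>
        intro y hy
        obtain ⟨a, ha, _, ⟨b, hb, rfl⟩, rfl⟩ := Submodule.mem_sup.1 hy
        obtain ⟨v, rfl | hv, rfl⟩ := hx
        · rw [LinearMap.mulLeft_apply, mul_add, ← mul_assoc, ι_sq_scalar, ← Algebra.smul_def,
            add_comm]
          exact hT (S.smul_mem hb _) ha
        · have swap : ι Q v * (a + ι Q w * b) =
              (ι Q v * a + QuadraticMap.polar Q v w • b) + ι Q w * -(ι Q v * b) := by
            rw [mul_add, ← mul_assoc, ι_mul_ι_comm, sub_mul, ← Algebra.smul_def]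
            noncomm_ring
          rw [LinearMap.mulLeft_apply, swap]
          exact hT (add_mem (mul_mem (hι hv) ha) (S.smul_mem hb _)) (neg_mem (mul_mem (hι hv) hb))
    intro x hx
    simpa using mul_mem_T hx 1 (Submodule.mem_sup_left (one_mem S))
  · have hS : S ≤ Algebra.adjoin R (ι Q '' insert w s) :=
      Algebra.adjoin_mono (Set.image_mono (Set.subset_insert w s))
    refine sup_le hS (Submodule.map_le_iff_le_comap.2 fun b hb => ?_)
    exact mul_mem (Algebra.subset_adjoin (Set.mem_image_of_mem _ (Set.mem_insert w s))) (hS hb)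

theorem adjoin_ι_image_eq_top {s : Set M} (hs : Submodule.span R s = ⊤) :
    Algebra.adjoin R (ι Q '' s) = ⊤ := by
  rw [← adjoin_range_ι, eq_comm]
  refine Algebra.adjoin_eq_of_le _ ?_ (Algebra.adjoin_mono (Set.image_subset_range _ _))
  rw [← LinearMap.coe_range, ← Submodule.map_top, ← hs, Submodule.map_span]
  exact Algebra.span_le_adjoin R _

instance cliffordAlgebra_finite [hM : Module.Finite R M] : Module.Finite R (CliffordAlgebra Q) := by
  classical
  obtain ⟨s, hs⟩ := hM.fg_top
  have fg (t : Finset M) : (Algebra.adjoin R (ι Q '' t)).toSubmodule.FG := by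
    induction t using Finset.induction_on with
    | empty =>
      rw [Finset.coe_empty, Set.image_empty, Algebra.adjoin_empty]
      exact Subalgebra.fg_bot_toSubmodule
    | insert w t _ ih =>
      rw [Finset.coe_insert, toSubmodule_adjoin_ι_image_insert]
      exact ih.sup (ih.map _)
  rw [Module.finite_def, ← Algebra.top_toSubmodule, ← adjoin_ι_image_eq_top hs]
  exact fg s

theorem mul_ι_eq_ι_mul_involute {w : M} {s : Set M} (hs : ∀ v ∈ s, Q.IsOrtho v w)
    {x : CliffordAlgebra Q} (hx : x ∈ Algebra.adjoin R (ι Q '' s)) :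
    x * ι Q w = ι Q w * involute x := by
  induction hx using Algebra.adjoin_induction with
  | algebraMap r => rw [AlgHom.commutes, Algebra.commutes]
  | add x y _ _ hx hy => rw [map_add, add_mul, mul_add, hx, hy]
  | mul x y _ _ hx hy => rw [map_mul, mul_assoc, hy, ← mul_assoc, hx, mul_assoc]
  | mem _ hx =>
    obtain ⟨v, hv, rfl⟩ := hx
    rw [involute_ι, mul_neg, ι_mul_ι_comm_of_isOrtho (hs v hv)]

theorem involute_mem_adjoin_ι_image {s : Set M} {x : CliffordAlgebra Q}
    (hx : x ∈ Algebra.adjoin R (ι Q '' s)) : involute x ∈ Algebra.adjoin R (ι Q '' s) := by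
  induction hx using Algebra.adjoin_induction with
  | algebraMap r => rw [AlgHom.commutes]; exact algebraMap_mem _ r
  | add x y _ _ hx hy => rw [map_add]; exact add_mem hx hy
  | mul x y _ _ hx hy => rw [map_mul]; exact mul_mem hx hy
  | mem x hx =>
    obtain ⟨v, -, rfl⟩ := id hx
    rw [involute_ι]
    exact neg_mem (Algebra.subset_adjoin hx)

theorem mem_adjoin_ι_image_of_commute [Invertible (2 : R)] {w : M} {s : Set M}
    (hs : ∀ v ∈ s, Q.IsOrtho v w) (hw : IsUnit (Q w)) {x : CliffordAlgebra Q}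
    (hx : x ∈ Algebra.adjoin R (ι Q '' insert w s)) (heven : involute x = x)
    (hcomm : Commute x (ι Q w)) : x ∈ Algebra.adjoin R (ι Q '' s) := by
  obtain ⟨a, ha, _, ⟨b, hb, rfl⟩, rfl⟩ := Submodule.mem_sup.1
    ((toSubmodule_adjoin_ι_image_insert (Q := Q) w s).le hx)
  simp only [LinearMap.mulLeft_apply] at heven hcomm ⊢
  have conj_eq : Q w • (a + ι Q w * b) = Q w • (involute a + ι Q w * involute b) := by
    have sq_mul (y : CliffordAlgebra Q) : Q w • y = ι Q w * (ι Q w * y) := by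
      rw [← mul_assoc, ι_sq_scalar, Algebra.smul_def]
    rw [sq_mul, ← hcomm.eq, add_mul, mul_assoc, mul_ι_eq_ι_mul_involute hs ha,
      mul_ι_eq_ι_mul_involute hs hb, ← mul_add, sq_mul]
  have conj_eq' : a + ι Q w * b = involute a + ι Q w * involute b :=
    hw.smul_left_cancel.1 conj_eq
  have even_eq : a + ι Q w * b = involute a - ι Q w * involute b := by
    rw [← heven, map_add, map_mul, involute_ι, neg_mul, sub_eq_add_neg]
  have two_mul_eq : (2 : R) • (a + ι Q w * b) = (2 : R) • involute a := by
    rw [two_smul R (a + _)]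
    nth_rewrite 1 [conj_eq']
    rw [even_eq, two_smul]
    abel
  rw [(isUnit_of_invertible (2 : R)).smul_left_cancel.1 two_mul_eq]
  exact involute_mem_adjoin_ι_image ha

theorem mem_bot_of_commute_ι [Invertible (2 : R)] {s : Finset M}
    (horth : (s : Set M).Pairwise Q.IsOrtho) (hunit : ∀ v ∈ s, IsUnit (Q v))
    {x : CliffordAlgebra Q} (hx : x ∈ Algebra.adjoin R (ι Q '' s)) (heven : involute x = x)
    (hcomm : ∀ v ∈ s, Commute x (ι Q v)) : x ∈ (⊥ : Subalgebra R (CliffordAlgebra Q)) := by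
  classical
  induction s using Finset.induction_on with
  | empty => simpa using hx
  | insert w s hws ih =>
    rw [Finset.coe_insert] at horth hx
    rw [Finset.forall_mem_insert] at hunit hcomm
    refine ih (horth.mono (Set.subset_insert _ _)) hunit.2
      (mem_adjoin_ι_image_of_commute (fun v hv => ?_) hunit.1 hx heven hcomm.1) hcomm.2
    exact horth (Set.mem_insert_of_mem _ hv) (Set.mem_insert _ _) fun h => hws (h ▸ hv)

end cliffordAlgebra

section spinCover

variable {n : ℕ}

/-- The reflection of `ℝⁿ` in the hyperplane orthogonal to a unit vector `u`. For other vectors the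
formula is not normalized, and the map is not a reflection. -/
def unitReflection (u : Fin n → ℝ) : (Fin n → ℝ) →ₗ[ℝ] (Fin n → ℝ) :=
  Module.preReflection u ((2 : ℝ) • dotProductBilin ℝ ℝ u)

theorem unitReflection_apply (u v : Fin n → ℝ) :
    unitReflection u v = v - (2 * (u ⬝ᵥ v)) • u := by
  simp [unitReflection, Module.preReflection_apply, dotProductBilin]

theorem det_unitReflection {u : Fin n → ℝ} (hu : u ⬝ᵥ u = 1) :
    LinearMap.det (unitReflection u) = -1 :=
  det_reflection_stdForm u (by simp [hu]) _ fun v => by rw [unitReflection_apply, hu, div_one]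

theorem ι_mul_self_of_dotProduct_self {u : Fin n → ℝ} (hu : u ⬝ᵥ u = 1) :
    ι (stdForm n) u * ι (stdForm n) u = -1 := by
  rw [ι_sq_scalar, stdForm_apply, hu, map_neg, map_one]

theorem ι_mul_ι_mul_ι_of_dotProduct_self {u : Fin n → ℝ} (hu : u ⬝ᵥ u = 1) (v : Fin n → ℝ) :
    ι (stdForm n) u * ι (stdForm n) v * ι (stdForm n) u = ι (stdForm n) (unitReflection u v) := by
  rw [ι_mul_ι_mul_ι, polar_stdForm, stdForm_apply, hu, unitReflection_apply, neg_smul, one_smul,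
    sub_neg_eq_add, neg_mul, neg_smul, neg_add_eq_sub]

theorem ι_mul_ι_mem_spinGroup {u w : Fin n → ℝ} (hu : u ⬝ᵥ u = 1) (hw : w ⬝ᵥ w = 1) :
    ι (stdForm n) u * ι (stdForm n) w ∈ spinGroup (stdForm n) := by
  let unitOf (v : Fin n → ℝ) (hv : v ⬝ᵥ v = 1) : (CliffordAlgebra (stdForm n))ˣ :=
    ⟨ι (stdForm n) v, -ι (stdForm n) v, by rw [mul_neg, ι_mul_self_of_dotProduct_self hv, neg_neg],
      by rw [neg_mul, ι_mul_self_of_dotProduct_self hv, neg_neg]⟩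
  have ι_mem_unitary {v : Fin n → ℝ} (hv : v ⬝ᵥ v = 1) :
      ι (stdForm n) v ∈ unitary (CliffordAlgebra (stdForm n)) := by
    simp [Unitary.mem_iff, star_ι, ι_mul_self_of_dotProduct_self hv]
  refine spinGroup.mem_iff.2 ⟨pinGroup.mem_iff.2 ⟨⟨unitOf u hu * unitOf w hw, mul_mem ?_ ?_, rfl⟩,
    mul_mem (ι_mem_unitary hu) (ι_mem_unitary hw)⟩, ?_⟩
  · exact Subgroup.subset_closure ⟨u, rfl⟩
  · exact Subgroup.subset_closure ⟨w, rfl⟩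
  · exact ι_mul_ι_mem_evenOdd_zero _ u w

theorem spinConj_of_coe_eq_ι_mul_ι {u w : Fin n → ℝ} (hu : u ⬝ᵥ u = 1) (hw : w ⬝ᵥ w = 1)
    {g : SpinGroup n} (hg : (g : CliffordAlgebra (stdForm n)) = ι _ u * ι _ w) :
    spinConj g = unitReflection u ∘ₗ unitReflection w := by
  refine LinearMap.ext fun v => clifford_ι_injective ?_
  rw [ι_spinConj, ← spinGroup.star_eq_inv, spinGroup.coe_star, hg, StarMul.star_mul, star_ι, star_ι,
    neg_mul_neg, LinearMap.comp_apply, ← ι_mul_ι_mul_ι_of_dotProduct_self hu,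
    ← ι_mul_ι_mul_ι_of_dotProduct_self hw]
  simp only [mul_assoc]

theorem spinCover_mulVec (g : SpinGroup n) (v : Fin n → ℝ) :
    (spinCover n g : Matrix (Fin n) (Fin n) ℝ) *ᵥ v = spinConj g v :=
  LinearMap.toMatrix'_mulVec _ _

theorem spinCover_eq_iff {g : SpinGroup n} {A : SOGroup n} :
    spinCover n g = A ↔ ∀ v, spinConj g v = (A : Matrix (Fin n) (Fin n) ℝ) *ᵥ v := by
  simp only [← spinCover_mulVec, ← Matrix.ext_iff_mulVec, ← Subtype.ext_iff]

theorem neg_one_mem_spinGroup (hn : 0 < n) : -1 ∈ spinGroup (stdForm n) := by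
  have unit_single : (Pi.single ⟨0, hn⟩ 1 : Fin n → ℝ) ⬝ᵥ Pi.single ⟨0, hn⟩ 1 = 1 := by simp
  rw [← ι_mul_self_of_dotProduct_self unit_single]
  exact ι_mul_ι_mem_spinGroup unit_single unit_single

theorem stdForm_isOrtho_iff {v w : Fin n → ℝ} : (stdForm n).IsOrtho v w ↔ v ⬝ᵥ w = 0 := by
  rw [← QuadraticMap.isOrtho_polarBilin, QuadraticMap.polarBilin_apply_apply, polar_stdForm]
  simp

theorem commute_ι_of_spinCover_eq_one {g : SpinGroup n} (hg : spinCover n g = 1)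
    (v : Fin n → ℝ) : Commute (g : CliffordAlgebra (stdForm n)) (ι _ v) := by
  have conj_eq := ι_spinConj g v
  rw [spinCover_eq_iff.1 hg v, OneMemClass.coe_one, Matrix.one_mulVec] at conj_eq
  rw [Commute, SemiconjBy, conj_eq, mul_assoc _ _ (g : CliffordAlgebra (stdForm n)),
    ← Submonoid.coe_mul, inv_mul_cancel, OneMemClass.coe_one, mul_one, ← conj_eq]

theorem eq_one_or_eq_neg_one_of_spinCover_eq_one {g : SpinGroup n} (hg : spinCover n g = 1) :
    (g : CliffordAlgebra (stdForm n)) = 1 ∨ (g : CliffordAlgebra (stdForm n)) = -1 := by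
  classical
  let basis : Finset (Fin n → ℝ) := Finset.univ.image (Pi.basisFun ℝ (Fin n))
  have span_basis : Submodule.span ℝ (basis : Set (Fin n → ℝ)) = ⊤ := by
    rw [Finset.coe_image, Finset.coe_univ, Set.image_univ, Module.Basis.span_eq]
  have basis_isOrtho : (basis : Set (Fin n → ℝ)).Pairwise (stdForm n).IsOrtho := by
    simp only [basis, Finset.coe_image, Finset.coe_univ, Set.image_univ]
    rintro _ ⟨i, rfl⟩ _ ⟨j, rfl⟩ hij
    simp [stdForm_isOrtho_iff, (ne_of_apply_ne _ hij).symm]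
  have isUnit_stdForm : ∀ v ∈ basis, IsUnit (stdForm n v) := by
    refine Finset.forall_mem_image.2 fun i _ => ?_
    rw [stdForm_apply, Pi.basisFun_apply]
    simp
  obtain ⟨c, hc⟩ := Algebra.mem_bot.1 <| mem_bot_of_commute_ι basis_isOrtho isUnit_stdForm
    (by rw [adjoin_ι_image_eq_top span_basis]; exact Algebra.mem_top) (spinGroup.involute_eq g.2)
    fun v _ => commute_ι_of_spinCover_eq_one hg v
  have c_mul_self : c * c = 1 := by
    apply FaithfulSMul.algebraMap_injective ℝ (CliffordAlgebra (stdForm n))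
    rw [map_mul, map_one, ← spinGroup.mul_star_self_of_mem g.2, ← hc, star_algebraMap]
  rw [← hc]
  rcases mul_self_eq_one_iff.1 c_mul_self with rfl | rfl
  · exact .inl (map_one _)
  · exact .inr (by rw [map_neg, map_one])

theorem exists_reflection_eq_unitReflection {v : EuclideanSpace ℝ (Fin n)} (hv : v ≠ 0) :
    ∃ u : Fin n → ℝ, u ⬝ᵥ u = 1 ∧ ∀ x,
      ((ℝ ∙ v)ᗮ.reflection x).ofLp = unitReflection u x.ofLp := by
  have norm_ne : ‖v‖ ≠ 0 := norm_ne_zero_iff.2 hv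
  have dotProduct_self : v.ofLp ⬝ᵥ v.ofLp = ‖v‖ ^ 2 := by
    rw [← real_inner_self_eq_norm_sq, EuclideanSpace.inner_eq_star_dotProduct, star_trivial]
  refine ⟨‖v‖⁻¹ • v.ofLp, ?_, fun x => ?_⟩
  · simp only [smul_dotProduct, dotProduct_smul, dotProduct_self, smul_eq_mul]
    field_simp
  · rw [Submodule.reflection_orthogonal_apply, Submodule.reflection_singleton_apply,
      EuclideanSpace.inner_eq_star_dotProduct, star_trivial, unitReflection_apply, dotProduct_comm]
    ext i
    simp only [WithLp.ofLp_neg, WithLp.ofLp_sub, WithLp.ofLp_smul, Pi.neg_apply, Pi.sub_apply,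
      Pi.smul_apply, smul_dotProduct, smul_eq_mul, two_smul, Pi.add_apply, WithLp.ofLp_add,
      RCLike.ofReal_real_eq_id, id]
    field_simp
    ring

theorem eq_spinConj_or_of_prod_reflection (l : List (EuclideanSpace ℝ (Fin n))) :
    ∃ g : SpinGroup n,
      (∀ x, ((l.map fun v => (ℝ ∙ v)ᗮ.reflection).prod x).ofLp = spinConj g x.ofLp) ∨
      ∃ u : Fin n → ℝ, u ⬝ᵥ u = 1 ∧ ∀ x,
        ((l.map fun v => (ℝ ∙ v)ᗮ.reflection).prod x).ofLp =
          unitReflection u (spinConj g x.ofLp) := by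
  induction l with
  | nil => exact ⟨1, .inl fun x => by simp [spinConj_one]⟩
  | cons v l ih =>
    simp only [List.map_cons, List.prod_cons, LinearIsometryEquiv.coe_mul, Function.comp_apply]
    rcases eq_or_ne v 0 with rfl | hv
    · have reflection_eq (y : EuclideanSpace ℝ (Fin n)) :
          (ℝ ∙ (0 : EuclideanSpace ℝ (Fin n)))ᗮ.reflection y = y := by
        rw [Submodule.reflection_orthogonal_apply, Submodule.reflection_singleton_apply]
        simp
      simpa only [reflection_eq] using ih
    obtain ⟨w, hw, reflection_eq⟩ := exists_reflection_eq_unitReflection hv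
    simp only [reflection_eq]
    obtain ⟨g, hg | ⟨u, hu, hg⟩⟩ := ih
    · exact ⟨g, .inr ⟨w, hw, fun x => by rw [hg]⟩⟩
    · refine ⟨⟨_, ι_mul_ι_mem_spinGroup hw hu⟩ * g, .inl fun x => ?_⟩
      rw [hg, spinConj_mul, spinConj_of_coe_eq_ι_mul_ι (g := ⟨_, _⟩) hw hu rfl]
      rfl

theorem so_mulVec_dotProduct_mulVec (A : SOGroup n) (v w : Fin n → ℝ) :
    (A : Matrix (Fin n) (Fin n) ℝ) *ᵥ v ⬝ᵥ (A : Matrix (Fin n) (Fin n) ℝ) *ᵥ w = v ⬝ᵥ w := by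
  rw [dotProduct_mulVec, ← mulVec_transpose, mulVec_mulVec,
    (mem_orthogonalGroup_iff' _ _).1 A.2.1, one_mulVec]

theorem spinCover_surjective : Function.Surjective (spinCover n) := by
  intro A
  let f : EuclideanSpace ℝ (Fin n) →ₗᵢ[ℝ] EuclideanSpace ℝ (Fin n) :=
    (Matrix.toEuclideanLin (A : Matrix (Fin n) (Fin n) ℝ)).isometryOfInner fun x y => by
      simp only [EuclideanSpace.inner_eq_star_dotProduct, star_trivial,
        Matrix.ofLp_toLpLin, Matrix.toLin'_apply, so_mulVec_dotProduct_mulVec]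
  obtain ⟨l, -, hl⟩ := (f.toLinearIsometryEquiv rfl).reflections_generate_dim
  obtain ⟨g, hg⟩ := eq_spinConj_or_of_prod_reflection l
  simp only [← hl, LinearIsometry.coe_toLinearIsometryEquiv] at hg
  refine ⟨g, spinCover_eq_iff.2 ?_⟩
  rcases hg with hg | ⟨u, hu, hg⟩
  · exact fun v => (hg (WithLp.toLp 2 v)).symm
  · have eq_comp : Matrix.toLin' A.1 = unitReflection u ∘ₗ spinConj g :=
      LinearMap.ext fun v => hg (WithLp.toLp 2 v)
    have det_eq := congrArg LinearMap.det eq_comp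
    rw [LinearMap.det_toLin', (Matrix.mem_specialOrthogonalGroup_iff.1 A.2).2, LinearMap.det_comp,
      det_unitReflection hu, det_spinConj] at det_eq
    norm_num at det_eq

theorem exists_spin_rotation {u v : Fin n → ℝ} (hu : u ⬝ᵥ u = 1) (hv : v ⬝ᵥ v = 1)
    (huv : 0 < 1 + u ⬝ᵥ v) :
    ∃ r : SpinGroup n,
      (r : CliffordAlgebra (stdForm n)) =
        (√(2 * (1 + u ⬝ᵥ v)))⁻¹ • (ι (stdForm n) (u + v) * ι (stdForm n) u) ∧
      spinConj r u = v ∧ ∀ w, u ⬝ᵥ w = 0 → v ⬝ᵥ w = 0 → spinConj r w = w := by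
  set c := 2 * (1 + u ⬝ᵥ v) with hc
  have c_pos : 0 < c := by positivity
  have inv_sqrt_mul_self : (√c)⁻¹ * (√c)⁻¹ = c⁻¹ := by
    rw [← mul_inv, Real.mul_self_sqrt c_pos.le]
  let p : Fin n → ℝ := (√c)⁻¹ • (u + v)
  have add_dotProduct_self : (u + v) ⬝ᵥ (u + v) = c := by
    simp only [add_dotProduct, dotProduct_add, hu, hv, dotProduct_comm v u, hc]
    ring
  have hp : p ⬝ᵥ p = 1 := by
    rw [smul_dotProduct, dotProduct_smul, smul_smul, inv_sqrt_mul_self, add_dotProduct_self,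
      smul_eq_mul, inv_mul_cancel₀ c_pos.ne']
  have p_reflection (w : Fin n → ℝ) :
      unitReflection p w = w - (2 * c⁻¹ * ((u + v) ⬝ᵥ w)) • (u + v) := by
    rw [unitReflection_apply, smul_dotProduct, smul_smul, ← inv_sqrt_mul_self, smul_eq_mul]
    ring_nf
  refine ⟨⟨_, ι_mul_ι_mem_spinGroup hp hu⟩, ?_, ?_, fun w huw hvw => ?_⟩
  · simp only [p, map_smul, smul_mul_assoc]
  · rw [spinConj_of_coe_eq_ι_mul_ι hp hu rfl, LinearMap.comp_apply, unitReflection_apply u u, hu,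
      p_reflection]
    have coeff : 2 * c⁻¹ * ((u + v) ⬝ᵥ (u - (2 * 1 : ℝ) • u)) = -1 := by
      simp only [dotProduct_sub, dotProduct_smul, add_dotProduct, hu, dotProduct_comm v u,
        smul_eq_mul]
      rw [hc]
      field_simp
      ring
    rw [coeff]
    module
  · rw [spinConj_of_coe_eq_ι_mul_ι hp hu rfl, LinearMap.comp_apply, unitReflection_apply u w, huw,
      p_reflection]
    simp [add_dotProduct, huw, hvw]

end spinCover

section blocks

variable {N : ℕ} {D : Fin N → ℕ}

theorem mem_spinProduct_of_spinCover_eq_one (hD : 0 < ∑ i, D i) {a : SpinGroup (∑ i, D i)}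
    (ha : spinCover _ a = 1) : a ∈ spinProduct D := by
  rcases eq_one_or_eq_neg_one_of_spinCover_eq_one ha with h | h
  · rw [show a = 1 from Subtype.ext h]
    exact one_mem _
  · obtain ⟨i, -, hi⟩ := Finset.sum_pos_iff.1 hD
    refine ⟨Pi.mulSingle i ⟨-1, neg_one_mem_spinGroup hi⟩, Subtype.ext ?_⟩
    rw [spinProductHom, MonoidHom.noncommPiCoprod_mulSingle, h]
    change CliffordAlgebra.map _ (-1) = _
    rw [map_neg, map_one]

theorem comap_spinCover_soProduct_le (hD : 0 < ∑ i, D i) :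
    (soProduct D).comap (spinCover _) ≤ spinProduct D := by
  rintro a ⟨A, hA⟩
  choose x hx using fun i => spinCover_surjective (A i)
  have cover_eq : spinCover _ (spinProductHom D x) = spinCover _ a := by
    rw [spinCover_spinProductHom, ← hA]
    simp only [hx]
  have inv_mul_mem : (spinProductHom D x)⁻¹ * a ∈ spinProduct D :=
    mem_spinProduct_of_spinCover_eq_one hD (by rw [map_mul, map_inv, cover_eq, inv_mul_cancel])
  exact (Subgroup.mul_mem_cancel_left _ (inv_mem (MonoidHom.mem_range.2 ⟨x, rfl⟩))).1 inv_mul_mem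

end blocks

section smoothness

variable {m : ℕ} {M : Type*} [TopologicalSpace M] [ChartedSpace (EuclideanSpace ℝ (Fin m)) M]

variable (m) in
/-- Smoothness on `U` of a map to a vector space, tested by all linear functionals. -/
def WeaklySmoothOn {V : Type*} [AddCommGroup V] [Module ℝ V] (f : M → V) (U : Set M) : Prop :=
  ∀ φ : V →ₗ[ℝ] ℝ, ContMDiffOn (𝓡 m) 𝓘(ℝ, ℝ) ∞ (fun x => φ (f x)) U

namespace WeaklySmoothOn

variable {V W : Type*} [AddCommGroup V] [Module ℝ V] [AddCommGroup W] [Module ℝ W]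
  {f g : M → V} {U : Set M}

theorem const (v : V) : WeaklySmoothOn m (fun _ : M => v) U := fun _ => contMDiffOn_const

theorem congr (hf : WeaklySmoothOn m f U) (h : ∀ x ∈ U, g x = f x) : WeaklySmoothOn m g U :=
  fun φ => (hf φ).congr fun x hx => by rw [h x hx]

theorem linearMap (hf : WeaklySmoothOn m f U) (T : V →ₗ[ℝ] W) :
    WeaklySmoothOn m (fun x => T (f x)) U := fun φ => hf (φ ∘ₗ T)

theorem mono (hf : WeaklySmoothOn m f U) {V : Set M} (hVU : V ⊆ U) : WeaklySmoothOn m f V :=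
  fun φ => (hf φ).mono hVU

theorem add (hf : WeaklySmoothOn m f U) (hg : WeaklySmoothOn m g U) :
    WeaklySmoothOn m (fun x => f x + g x) U := fun φ => by
  simp only [map_add]
  exact (hf φ).add (hg φ)

theorem sum {ι : Type*} {s : Finset ι} {f : ι → M → V} (hf : ∀ i ∈ s, WeaklySmoothOn m (f i) U) :
    WeaklySmoothOn m (fun x => ∑ i ∈ s, f i x) U := fun φ => by
  simpa only [map_sum] using contMDiffOn_finsetSum fun i hi => hf i hi φ

theorem smul {c : M → ℝ} (hc : ContMDiffOn (𝓡 m) 𝓘(ℝ, ℝ) ∞ c U) (hf : WeaklySmoothOn m f U) :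
    WeaklySmoothOn m (fun x => c x • f x) U := fun φ => by
  simp only [map_smul]
  exact hc.smul (hf φ)

theorem mul {A : Type*} [Ring A] [Algebra ℝ A] [FiniteDimensional ℝ A] {f g : M → A}
    (hf : WeaklySmoothOn m f U) (hg : WeaklySmoothOn m g U) :
    WeaklySmoothOn m (fun x => f x * g x) U := by
  let b := Module.finBasis ℝ A
  have h : WeaklySmoothOn m (fun x => ∑ i, b.coord i (f x) • (b i * g x)) U :=
    sum fun i _ => smul (hf (b.coord i)) (hg.linearMap (LinearMap.mulLeft ℝ (b i)))
  refine h.congr fun x _ => ?_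
  simp only [← smul_mul_assoc, ← Finset.sum_mul, Module.Basis.coord_apply, b.sum_repr]

theorem of_matrix {p q : ℕ} {A : M → Matrix (Fin p) (Fin q) ℝ}
    (hA : ∀ i j, ContMDiffOn (𝓡 m) 𝓘(ℝ, ℝ) ∞ (fun x => A x i j) U) : WeaklySmoothOn m A U := by
  have h : WeaklySmoothOn m
      (fun x => ∑ i, ∑ j, A x i j • (Matrix.single i j 1 : Matrix (Fin p) (Fin q) ℝ)) U :=
    sum fun i _ => sum fun j _ => smul (hA i j) (const _)
  refine h.congr fun x _ => ?_
  conv_lhs => rw [Matrix.matrix_eq_sum_single (A x)]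
  simp

end WeaklySmoothOn

theorem SmoothIntoGroup.mono {G : Type*} [SmoothCoordinates G] {h : M → G} {U V : Set M}
    (hh : SmoothIntoGroup m h U) (hVU : V ⊆ U) : SmoothIntoGroup m h V :=
  fun c hc => (hh c hc).mono hVU

theorem SmoothIntoGroup.congr {G : Type*} [SmoothCoordinates G] {h k : M → G} {U : Set M}
    (hh : SmoothIntoGroup m h U) (hk : ∀ x ∈ U, k x = h x) : SmoothIntoGroup m k U :=
  fun c hc => (hh c hc).congr fun x hx => by rw [hk x hx]

theorem smoothIntoGroup_of_locally {G : Type*} [SmoothCoordinates G] {h : M → G} {U : Set M}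
    (hh : ∀ x ∈ U, ∃ W, IsOpen W ∧ x ∈ W ∧ SmoothIntoGroup m h (U ∩ W)) :
    SmoothIntoGroup m h U := fun c hc =>
  contMDiffOn_of_locally_contMDiffOn fun x hx =>
    let ⟨W, hW, hxW, hs⟩ := hh x hx
    ⟨W, hW, hxW, hs c hc⟩

theorem smoothIntoGroup_spin_iff {n : ℕ} {h : M → SpinGroup n} {U : Set M} :
    SmoothIntoGroup m h U ↔
      WeaklySmoothOn m (fun x => (h x : CliffordAlgebra (stdForm n))) U :=
  ⟨fun hh φ => hh _ ⟨φ, rfl⟩, by rintro hh _ ⟨φ, rfl⟩; exact hh φ⟩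

theorem smoothIntoGroup_so_iff {n : ℕ} {h : M → SOGroup n} {U : Set M} :
    SmoothIntoGroup m h U ↔
      WeaklySmoothOn m (fun x => (h x : Matrix (Fin n) (Fin n) ℝ)) U :=
  ⟨fun hh φ => hh _ ⟨φ, rfl⟩, by rintro hh _ ⟨φ, rfl⟩; exact hh φ⟩

theorem SmoothIntoGroup.so_entry {n : ℕ} {h : M → SOGroup n} {U : Set M}
    (hh : SmoothIntoGroup m h U) (i j : Fin n) :
    ContMDiffOn (𝓡 m) 𝓘(ℝ, ℝ) ∞ (fun x => (h x : Matrix (Fin n) (Fin n) ℝ) i j) U :=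
  smoothIntoGroup_so_iff.1 hh (entryLinearMap ℝ ℝ i j)

theorem smoothIntoGroup_subgroup_iff {G : Type*} [Group G] [SmoothCoordinates G] {K : Subgroup G}
    {h : M → K} {U : Set M} :
    SmoothIntoGroup m h U ↔ SmoothIntoGroup m (fun x => (h x : G)) U :=
  ⟨fun hh c hc => hh _ ⟨c, hc, rfl⟩, by rintro hh _ ⟨c, hc, rfl⟩; exact hh c hc⟩

variable (m M) in
/-- Products of smooth maps from the `m`-manifold `M` to `G` are smooth. -/
def HasSmoothMul (G : Type*) [Group G] [SmoothCoordinates G] : Prop :=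
  ∀ (U : Set M) (h k : M → G), SmoothIntoGroup m h U → SmoothIntoGroup m k U →
    SmoothIntoGroup m (fun x => h x * k x) U

theorem hasSmoothMul_spin (n : ℕ) : HasSmoothMul m M (SpinGroup n) := fun _ _ _ hh hk =>
  smoothIntoGroup_spin_iff.2
    ((smoothIntoGroup_spin_iff.1 hh).mul (smoothIntoGroup_spin_iff.1 hk))

theorem hasSmoothMul_so (n : ℕ) : HasSmoothMul m M (SOGroup n) := fun _ _ _ hh hk =>
  smoothIntoGroup_so_iff.2 ((smoothIntoGroup_so_iff.1 hh).mul (smoothIntoGroup_so_iff.1 hk))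

theorem HasSmoothMul.subgroup {G : Type*} [Group G] [SmoothCoordinates G]
    (hG : HasSmoothMul m M G) (K : Subgroup G) : HasSmoothMul m M K := fun _ _ _ hh hk =>
  smoothIntoGroup_subgroup_iff.2
    (hG _ _ _ (smoothIntoGroup_subgroup_iff.1 hh) (smoothIntoGroup_subgroup_iff.1 hk))

theorem WeaklySmoothOn.star {n : ℕ} {f : M → CliffordAlgebra (stdForm n)} {U : Set M}
    (hf : WeaklySmoothOn m f U) : WeaklySmoothOn m (fun x => star (f x)) U :=
  hf.linearMap (reverse ∘ₗ involute.toLinearMap)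

theorem SmoothIntoGroup.spinCover {n : ℕ} {h : M → SpinGroup n} {U : Set M}
    (hh : SmoothIntoGroup m h U) : SmoothIntoGroup m (fun x => spinCover n (h x)) U := by
  rw [smoothIntoGroup_spin_iff] at hh
  rw [smoothIntoGroup_so_iff]
  obtain ⟨π, hπ⟩ := (ι (stdForm n)).exists_leftInverse_of_injective
    (LinearMap.ker_eq_bot.2 clifford_ι_injective)
  refine WeaklySmoothOn.of_matrix fun i j => ?_
  have h1 := ((hh.mul (.const (ι (stdForm n) (Pi.single j 1)))).mul hh.star)
    (LinearMap.proj i ∘ₗ π)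
  refine h1.congr fun x _ => ?_
  have h2 : (h x : CliffordAlgebra (stdForm n)) * ι (stdForm n) (Pi.single j 1) *
      Star.star (h x : CliffordAlgebra (stdForm n)) =
      ι (stdForm n) (spinConj (h x) (Pi.single j 1)) := (ι_spinConj _ _).symm
  have h3 : π (ι (stdForm n) (spinConj (h x) (Pi.single j 1))) =
      spinConj (h x) (Pi.single j 1) := LinearMap.congr_fun hπ _
  exact ((LinearMap.toMatrix'_apply _ _ _).trans (congrFun h3 i).symm).trans
    (congrArg (LinearMap.proj i ∘ₗ π) h2).symm

theorem SmoothIntoGroup.inv_spin {n : ℕ} {h : M → SpinGroup n} {U : Set M}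
    (hh : SmoothIntoGroup m h U) : SmoothIntoGroup m (fun x => (h x)⁻¹) U :=
  smoothIntoGroup_spin_iff.2 (smoothIntoGroup_spin_iff.1 hh).star

section localLift

variable {G H : Type*} [Group G] [SmoothCoordinates G] [Group H] {φ : G →* H}

variable (m) in
/-- Around the point `x₀` the map `h` to `H` has a smooth lift along `φ : G → H`. -/
def LiftsSmoothlyAt (φ : G →* H) (h : M → H) (x₀ : M) : Prop :=
  ∃ W, IsOpen W ∧ x₀ ∈ W ∧ ∃ k : M → G, SmoothIntoGroup m k W ∧ ∀ x ∈ W, φ (k x) = h x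

theorem LiftsSmoothlyAt.mul (hG : HasSmoothMul m M G) {h h' : M → H} {x₀ : M}
    (hh : LiftsSmoothlyAt m φ h x₀) (hh' : LiftsSmoothlyAt m φ h' x₀) :
    LiftsSmoothlyAt m φ (fun x => h x * h' x) x₀ := by
  obtain ⟨W, hW, hxW, k, hk, hkh⟩ := hh
  obtain ⟨W', hW', hxW', k', hk', hkh'⟩ := hh'
  exact ⟨W ∩ W', hW.inter hW', ⟨hxW, hxW'⟩, fun x => k x * k' x,
    hG _ _ _ (hk.mono Set.inter_subset_left) (hk'.mono Set.inter_subset_right),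
    fun x hx => by rw [map_mul, hkh x hx.1, hkh' x hx.2]⟩

theorem LiftsSmoothlyAt.congr {h h' : M → H} {x₀ : M} (hh : LiftsSmoothlyAt m φ h x₀)
    {U : Set M} (hU : IsOpen U) (hx₀ : x₀ ∈ U) (h_eq : ∀ x ∈ U, h' x = h x) :
    LiftsSmoothlyAt m φ h' x₀ := by
  obtain ⟨W, hW, hxW, k, hk, hkh⟩ := hh
  exact ⟨U ∩ W, hU.inter hW, ⟨hx₀, hxW⟩, k, hk.mono Set.inter_subset_right,
    fun x hx => (hkh x hx.2).trans (h_eq x hx.1).symm⟩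

theorem liftsSmoothlyAt_const (hφ : Function.Surjective φ) (b : H) (x₀ : M) :
    LiftsSmoothlyAt m φ (fun _ => b) x₀ :=
  let ⟨a, ha⟩ := hφ b
  ⟨Set.univ, isOpen_univ, Set.mem_univ _, fun _ => a, fun _ _ => contMDiffOn_const, fun _ _ => ha⟩

end localLift

theorem exists_smooth_spin_rotation {n : ℕ} {u : Fin n → ℝ} (hu : u ⬝ᵥ u = 1) {v : M → Fin n → ℝ}
    {U : Set M} (hv : WeaklySmoothOn m v U) (hvv : ∀ x ∈ U, v x ⬝ᵥ v x = 1)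
    (huv : ∀ x ∈ U, 0 < 1 + u ⬝ᵥ v x) :
    ∃ r : M → SpinGroup n, SmoothIntoGroup m r U ∧ ∀ x ∈ U,
      spinConj (r x) u = v x ∧ ∀ w, u ⬝ᵥ w = 0 → v x ⬝ᵥ w = 0 → spinConj (r x) w = w := by
  choose! r coe_r hr using fun x (hx : x ∈ U) => exists_spin_rotation hu (hvv x hx) (huv x hx)
  refine ⟨r, ?_, hr⟩
  have smooth_scale : ContMDiffOn (𝓡 m) 𝓘(ℝ, ℝ) ∞ (fun x => (√(2 * (1 + u ⬝ᵥ v x)))⁻¹) U := by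
    have smooth_arg : ContMDiffOn (𝓡 m) 𝓘(ℝ, ℝ) ∞ (fun x => 2 * (1 + u ⬝ᵥ v x)) U :=
      contMDiffOn_const.mul (contMDiffOn_const.add (hv (dotProductBilin ℝ ℝ u)))
    have arg_pos {x : M} (hx : x ∈ U) : 0 < 2 * (1 + u ⬝ᵥ v x) := mul_pos two_pos (huv x hx)
    exact ContMDiffOn.inv₀ (fun x hx => ContDiffAt.comp_contMDiffWithinAt
      (Real.contDiffAt_sqrt (arg_pos hx).ne') (smooth_arg x hx))
      fun x hx => (Real.sqrt_pos.2 (arg_pos hx)).ne'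
  have smooth_product : WeaklySmoothOn m (fun x => ι (stdForm n) (u + v x) * ι (stdForm n) u) U :=
    (((WeaklySmoothOn.const u).add hv).linearMap (ι (stdForm n))).mul (.const _)
  exact smoothIntoGroup_spin_iff.2 ((smooth_product.smul smooth_scale).congr coe_r)

theorem exists_smooth_spin_rotation_single {n : ℕ} (i : Fin n) {h : M → SOGroup n} {U : Set M}
    (hU : IsOpen U) (hh : SmoothIntoGroup m h U) {x₀ : M} (hx₀ : x₀ ∈ U) (h_one : h x₀ = 1) :
    ∃ W ⊆ U, IsOpen W ∧ x₀ ∈ W ∧ ∃ r : M → SpinGroup n, SmoothIntoGroup m r W ∧ ∀ x ∈ W, ∀ j,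
      (j ≠ i → (h x : Matrix (Fin n) (Fin n) ℝ) *ᵥ Pi.single j 1 = Pi.single j 1) →
      spinConj (r x) (Pi.single j 1) = (h x : Matrix (Fin n) (Fin n) ℝ) *ᵥ Pi.single j 1 := by
  let e (j : Fin n) : Fin n → ℝ := Pi.single j 1
  have dotProduct_e (j k : Fin n) : e j ⬝ᵥ e k = if j = k then 1 else 0 := by
    simp [e, Pi.single_apply, eq_comm]
  have he : e i ⬝ᵥ e i = 1 := by rw [dotProduct_e, if_pos rfl]
  let v (x : M) : Fin n → ℝ := (h x : Matrix (Fin n) (Fin n) ℝ) *ᵥ e i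
  have v_x₀ : v x₀ = e i := by simp only [v, h_one, OneMemClass.coe_one, one_mulVec]
  have smooth_v : WeaklySmoothOn m v U :=
    (smoothIntoGroup_so_iff.1 hh).linearMap (LinearMap.applyₗ (e i) ∘ₗ toLin'.toLinearMap)
  let W : Set M := U ∩ (fun x => e i ⬝ᵥ v x) ⁻¹' Set.Ioi (-1)
  have hW : IsOpen W :=
    (smooth_v (dotProductBilin ℝ ℝ (e i))).continuousOn.isOpen_inter_preimage hU isOpen_Ioi
  have hx₀W : x₀ ∈ W := ⟨hx₀, by
    rw [Set.mem_preimage, v_x₀, he]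
    norm_num⟩
  obtain ⟨r, smooth_r, hr⟩ := exists_smooth_spin_rotation he (smooth_v.mono Set.inter_subset_left)
    (fun x _ => (so_mulVec_dotProduct_mulVec _ _ _).trans he)
    fun x hx => neg_lt_iff_pos_add'.1 hx.2
  refine ⟨W, Set.inter_subset_left, hW, hx₀W, r, smooth_r, fun x hx j hj => ?_⟩
  rcases eq_or_ne j i with rfl | hji
  · exact (hr x hx).1
  · have v_orthogonal : v x ⬝ᵥ e j = 0 := by
      rw [← show _ = e j from hj hji, so_mulVec_dotProduct_mulVec, dotProduct_e, if_neg hji.symm]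
    rw [hj hji, (hr x hx).2 _ (by rw [dotProduct_e, if_neg hji.symm]) v_orthogonal]

theorem liftsSmoothlyAt_spinCover_of_fixes {n : ℕ} (s : Finset (Fin n)) {h : M → SOGroup n}
    {U : Set M} (hU : IsOpen U) (hh : SmoothIntoGroup m h U) {x₀ : M} (hx₀ : x₀ ∈ U)
    (h_one : h x₀ = 1)
    (h_fix : ∀ x ∈ U, ∀ j ∉ s, (h x : Matrix (Fin n) (Fin n) ℝ) *ᵥ Pi.single j 1 = Pi.single j 1) :
    LiftsSmoothlyAt m (spinCover n) h x₀ := by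
  induction s using Finset.induction_on generalizing h U with
  | empty =>
    refine (liftsSmoothlyAt_const spinCover_surjective 1 x₀).congr hU hx₀ fun x hx => ?_
    refine Subtype.ext (ext_of_mulVec_single fun j => ?_)
    rw [h_fix x hx j (Finset.notMem_empty j), OneMemClass.coe_one, one_mulVec]
  | insert i s _ ih =>
    obtain ⟨W, hWU, hW, hx₀W, r, smooth_r, hr⟩ :=
      exists_smooth_spin_rotation_single i hU hh hx₀ h_one
    have cover_r : spinCover n (r x₀) = h x₀ :=
      Subtype.ext <| ext_of_mulVec_single fun j => (spinCover_mulVec _ _).trans <|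
        hr x₀ hx₀W j fun _ => by rw [h_one, OneMemClass.coe_one, one_mulVec]
    have lift_rest : LiftsSmoothlyAt m (spinCover n) (fun x => spinCover n (r x)⁻¹ * h x) x₀ := by
      refine ih hW (hasSmoothMul_so n _ _ _ smooth_r.inv_spin.spinCover (hh.mono hWU)) hx₀W
        (by rw [map_inv, cover_r, inv_mul_cancel]) fun x hx j hj => ?_
      have h_mulVec := hr x hx j fun hji =>
        h_fix x (hWU hx) j fun hjs => hj ((Finset.mem_insert.1 hjs).resolve_left hji)
      rw [Submonoid.coe_mul, ← mulVec_mulVec, ← h_mulVec, spinCover_mulVec,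
        ← LinearMap.comp_apply, ← spinConj_mul, inv_mul_cancel, spinConj_one, LinearMap.id_apply]
    have lift_r : LiftsSmoothlyAt m (spinCover n) (fun x => spinCover n (r x)) x₀ :=
      ⟨W, hW, hx₀W, r, smooth_r, fun _ _ => rfl⟩
    refine (lift_r.mul (hasSmoothMul_spin n) lift_rest).congr isOpen_univ (Set.mem_univ _) ?_
    intro x _
    rw [map_inv, mul_inv_cancel_left]

theorem liftsSmoothlyAt_spinCover {n : ℕ} {h : M → SOGroup n}
    {U : Set M} (hU : IsOpen U) (hh : SmoothIntoGroup m h U) {x₀ : M} (hx₀ : x₀ ∈ U) :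
    LiftsSmoothlyAt m (spinCover n) h x₀ := by
  have lift_translate : LiftsSmoothlyAt m (spinCover n) (fun x => h x * (h x₀)⁻¹) x₀ :=
    liftsSmoothlyAt_spinCover_of_fixes Finset.univ hU
      (hasSmoothMul_so n _ _ _ hh fun _ _ => contMDiffOn_const) hx₀ (mul_inv_cancel _)
      fun _ _ j hj => (hj (Finset.mem_univ j)).elim
  refine (lift_translate.mul (hasSmoothMul_spin n)
    (liftsSmoothlyAt_const spinCover_surjective (h x₀) x₀)).congr hU hx₀ fun x _ => ?_
  rw [inv_mul_cancel_right]

end smoothness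

section frameBundle

variable {n : ℕ} {M : Type*} [TopologicalSpace M] [ChartedSpace (EuclideanSpace ℝ (Fin n)) M]
  [IsManifold (𝓡 n) ∞ M] {g : RiemannianMetricOn n M} {o : ManifoldOrientation n M}

theorem IsOrientedOrthonormal.exists_mul_eq {x : M} {e f : Fin n → TangentSpace (𝓡 n) x}
    (he : IsOrientedOrthonormal g o x e) (hf : IsOrientedOrthonormal g o x f) :
    ∃ A : SOGroup n, (fun j => ∑ i, (A : Matrix (Fin n) (Fin n) ℝ) i j • e i) = f := by
  obtain ⟨b, hbe, hb⟩ := he.positive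
  obtain ⟨c, hcf, hc⟩ := hf.positive
  have expand (j : Fin n) : ∑ i, b.toMatrix f i j • e i = f j :=
    hbe ▸ b.sum_toMatrix_smul_self f j
  have orthogonal : (b.toMatrix f)ᵀ * b.toMatrix f = 1 := by
    ext j k
    rw [mul_apply, one_apply, ← hf.orthonormal, ← expand j, ← expand k]
    simp [he.orthonormal, mul_comm]
  have det_pos : 0 < (b.toMatrix f).det := by
    rw [← b.det_apply, ← hcf]
    exact (b.orientation_eq_iff_det_pos c).1 (hb.trans hc.symm)
  have det_sq : (b.toMatrix f).det * (b.toMatrix f).det = 1 := by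
    simpa only [det_mul, det_transpose, det_one] using congrArg det orthogonal
  exact ⟨⟨b.toMatrix f, mem_specialOrthogonalGroup_iff.2
    ⟨(mem_orthogonalGroup_iff' _ _).2 orthogonal, by nlinarith⟩⟩, funext expand⟩

/-- The `i`-th vector of the frame `p`, as a tangent vector at `x`; it is zero unless `p` is a frame
at `x`. This turns a local section of the frame bundle into vector fields on `M`. -/
def OrthonormalFrames.vectorAt (p : OrthonormalFrames g o) (x : M) (i : Fin n) :
    TangentSpace (𝓡 n) x :=
  open Classical in if h : p.1 = x then h ▸ p.2.1 i else 0

theorem OrthonormalFrames.mk_vectorAt {p : OrthonormalFrames g o} {x : M} (h : p.1 = x)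
    (i : Fin n) : (⟨x, p.vectorAt x i⟩ : TangentBundle (𝓡 n) M) = ⟨p.1, p.2.1 i⟩ := by
  subst h
  simp [vectorAt]

theorem mem_frameBundle_smoothSections_iff {V : Set M} {t : M → OrthonormalFrames g o} :
    (V, t) ∈ (frameBundle g o).smoothSections ↔ IsOpen V ∧ (∀ x ∈ V, (t x).1 = x) ∧
      ∀ i, ContMDiffOn (𝓡 n) (𝓡 n).tangent ∞
        (fun x => (⟨x, (t x).vectorAt x i⟩ : TangentBundle (𝓡 n) M)) V :=
  and_congr_right fun _ => and_congr_right fun ht => forall_congr' fun i =>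
    contMDiffOn_congr fun x hx => (OrthonormalFrames.mk_vectorAt (ht x hx) i).symm

theorem frameBundle_act_vectorAt (p : OrthonormalFrames g o) (A : SOGroup n) (x : M) (j : Fin n) :
    ((frameBundle g o).act p A).vectorAt x j =
      ∑ i, (A : Matrix (Fin n) (Fin n) ℝ) i j • p.vectorAt x i := by
  by_cases h : p.1 = x
  · subst h
    simp [OrthonormalFrames.vectorAt, frameBundle]
  · simp [OrthonormalFrames.vectorAt, frameBundle, h]

theorem inner_vectorAt_frameBundle_act {p : OrthonormalFrames g o} {x : M} (hp : p.1 = x)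
    (A : SOGroup n) (i j : Fin n) :
    g.inner x (p.vectorAt x i) (((frameBundle g o).act p A).vectorAt x j) =
      (A : Matrix (Fin n) (Fin n) ℝ) i j := by
  subst hp
  simp [OrthonormalFrames.vectorAt, frameBundle, p.2.2.orthonormal]

theorem frameBundle_existsUnique_act {p q : OrthonormalFrames g o} (h : p.1 = q.1) :
    ∃! A, (frameBundle g o).act p A = q := by
  obtain ⟨x, e, he⟩ := p
  obtain ⟨y, f, hf⟩ := q
  obtain rfl : x = y := h
  obtain ⟨A, rfl⟩ := he.exists_mul_eq hf
  refine ⟨A, rfl, fun A' hA' => Subtype.ext (Matrix.ext fun i j => ?_)⟩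
  rw [← inner_vectorAt_frameBundle_act (p := ⟨x, e, he⟩) rfl A', hA']
  exact inner_vectorAt_frameBundle_act (p := ⟨x, e, he⟩) rfl A i j

theorem contMDiffOn_metric {U : Set M} {v w : ∀ x : M, TangentSpace (𝓡 n) x}
    (hv : ContMDiffOn (𝓡 n) (𝓡 n).tangent ∞ (fun x => (⟨x, v x⟩ : TangentBundle (𝓡 n) M)) U)
    (hw : ContMDiffOn (𝓡 n) (𝓡 n).tangent ∞ (fun x => (⟨x, w x⟩ : TangentBundle (𝓡 n) M)) U) :
    ContMDiffOn (𝓡 n) 𝓘(ℝ, ℝ) ∞ (fun x => g.inner x (v x) (w x)) U := by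
  intro x hx
  have h : ContMDiffWithinAt (𝓡 n) ((𝓡 n).prod 𝓘(ℝ)) ∞
      (fun y => Bundle.TotalSpace.mk' ℝ (E := Bundle.Trivial M ℝ) y
        (g.inner y (v y) (w y))) U x :=
    ContMDiffWithinAt.clm_bundle_apply₂ (F₁ := EuclideanSpace ℝ (Fin n))
      (F₂ := EuclideanSpace ℝ (Fin n)) g.contMDiff.contMDiffAt.contMDiffWithinAt (hv x hx) (hw x hx)
  exact (Bundle.contMDiffWithinAt_totalSpace.1 h).2

theorem frameBundle_exists_smooth_act {σ τ : Set M × (M → OrthonormalFrames g o)}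
    (hσ : σ ∈ (frameBundle g o).smoothSections) (hτ : τ ∈ (frameBundle g o).smoothSections) :
    ∃ h : M → SOGroup n, SmoothIntoGroup n h (σ.1 ∩ τ.1) ∧
      ∀ x ∈ σ.1 ∩ τ.1, τ.2 x = (frameBundle g o).act (σ.2 x) (h x) := by
  obtain ⟨-, proj_σ, smooth_σ⟩ := mem_frameBundle_smoothSections_iff.1 hσ
  obtain ⟨-, proj_τ, smooth_τ⟩ := mem_frameBundle_smoothSections_iff.1 hτ
  choose! h hh using fun x (hx : x ∈ σ.1 ∩ τ.1) =>
    (frameBundle_existsUnique_act ((proj_σ x hx.1).trans (proj_τ x hx.2).symm)).exists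
  refine ⟨h, smoothIntoGroup_so_iff.2 (WeaklySmoothOn.of_matrix fun i j => ?_),
    fun x hx => (hh x hx).symm⟩
  refine (contMDiffOn_metric (g := g) ((smooth_σ i).mono Set.inter_subset_left)
    ((smooth_τ j).mono Set.inter_subset_right)).congr fun x hx => ?_
  rw [← hh x hx, inner_vectorAt_frameBundle_act (proj_σ x hx.1)]

theorem contMDiffOn_frameBundle_act_vectorAt {σ : Set M × (M → OrthonormalFrames g o)}
    (hσ : σ ∈ (frameBundle g o).smoothSections) {h : M → SOGroup n} {W : Set M} (hW : W ⊆ σ.1)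
    (hh : SmoothIntoGroup n h W) (j : Fin n) :
    ContMDiffOn (𝓡 n) (𝓡 n).tangent ∞ (fun x =>
      (⟨x, ((frameBundle g o).act (σ.2 x) (h x)).vectorAt x j⟩ : TangentBundle (𝓡 n) M)) W := by
  simp only [frameBundle_act_vectorAt]
  exact ContMDiffOn.sum_section fun i _ => ContMDiffOn.smul_section (hh.so_entry i j)
    (((mem_frameBundle_smoothSections_iff.1 hσ).2.2 i).mono hW)

theorem frameBundle_isPrincipalBundle
    (exists_section : ∀ x, ∃ σ ∈ (frameBundle g o).smoothSections, x ∈ σ.1) :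
    IsPrincipalBundle n (frameBundle g o) where
  act_one p := Sigma.ext rfl <| heq_of_eq <| Subtype.ext <| funext fun j => by
    simp [frameBundle, one_apply]
  act_mul p A A' := Sigma.ext rfl <| heq_of_eq <| Subtype.ext <| funext fun j => by
    simp only [frameBundle, Submonoid.coe_mul, mul_apply, Finset.sum_smul, Finset.smul_sum,
      smul_smul]
    rw [Finset.sum_comm]
    simp only [mul_comm]
  proj_act _ _ := rfl
  existsUnique_act _ _ := frameBundle_existsUnique_act
  isOpen _ hσ := hσ.1
  proj_section _ hσ := hσ.2.1
  exists_section := exists_section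
  mem_smoothSections_iff V t hV ht := by
    refine ⟨fun ht' σ hσ => frameBundle_exists_smooth_act hσ ht', fun h =>
      mem_frameBundle_smoothSections_iff.2 ⟨hV, ht, fun j => ?_⟩⟩
    refine contMDiffOn_of_locally_contMDiffOn fun x _ => ?_
    obtain ⟨σ, hσ, hxσ⟩ := exists_section x
    obtain ⟨k, smooth_k, hk⟩ := h σ hσ
    refine ⟨σ.1, hσ.1, hxσ, ?_⟩
    rw [Set.inter_comm]
    refine (contMDiffOn_frameBundle_act_vectorAt hσ Set.inter_subset_left smooth_k j).congr
      fun y hy => ?_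
    rw [hk y hy]

end frameBundle

section principalBundles

variable {m : ℕ} {M : Type*} [TopologicalSpace M] [ChartedSpace (EuclideanSpace ℝ (Fin m)) M]

namespace IsPrincipalBundle

variable {G P : Type*} [Group G] [SmoothCoordinates G] {B : PrincipalBundleData M G P}

theorem act_injective (hB : IsPrincipalBundle m B) (p : P) : Function.Injective (B.act p) :=
  fun _ b hab => (hB.existsUnique_act p (B.act p b) (hB.proj_act p b).symm).unique hab rfl

theorem exists_transition (hB : IsPrincipalBundle m B) {σ τ : Set M × (M → P)}
    (hσ : σ ∈ B.smoothSections) (hτ : τ ∈ B.smoothSections) :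
    ∃ h : M → G, SmoothIntoGroup m h (σ.1 ∩ τ.1) ∧
      ∀ x ∈ σ.1 ∩ τ.1, τ.2 x = B.act (σ.2 x) (h x) :=
  (hB.mem_smoothSections_iff τ.1 τ.2 (hB.isOpen τ hτ) (hB.proj_section τ hτ)).1 hτ σ hσ

theorem mem_smoothSections_of_act (hB : IsPrincipalBundle m B) (hG : HasSmoothMul m M G)
    {σ : Set M × (M → P)} (hσ : σ ∈ B.smoothSections) {W : Set M} (hW : IsOpen W) (hWσ : W ⊆ σ.1)
    {k : M → G} (hk : SmoothIntoGroup m k W) {t : M → P}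
    (ht : ∀ x ∈ W, t x = B.act (σ.2 x) (k x)) : (W, t) ∈ B.smoothSections := by
  have proj_t (x : M) (hx : x ∈ W) : B.proj (t x) = x := by
    rw [ht x hx, hB.proj_act, hB.proj_section σ hσ x (hWσ hx)]
  refine (hB.mem_smoothSections_iff W t hW proj_t).2 fun τ hτ => ?_
  obtain ⟨r, smooth_r, hr⟩ := hB.exists_transition hτ hσ
  refine ⟨fun x => r x * k x, hG _ _ _ (smooth_r.mono (Set.inter_subset_inter_right _ hWσ))
    (hk.mono Set.inter_subset_right), fun x hx => ?_⟩
  rw [hB.act_mul, ← hr x ⟨hx.1, hWσ hx.2⟩, ht x hx.2]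

theorem mem_smoothSections_of_locally (hB : IsPrincipalBundle m B) {V : Set M} {t : M → P}
    (h : ∀ x ∈ V, ∃ W ⊆ V, x ∈ W ∧ (W, t) ∈ B.smoothSections) : (V, t) ∈ B.smoothSections := by
  have hV : IsOpen V := isOpen_iff_forall_mem_open.2 fun x hx =>
    let ⟨W, hWV, hxW, hWt⟩ := h x hx
    ⟨W, hWV, hB.isOpen _ hWt, hxW⟩
  have proj_t (x : M) (hx : x ∈ V) : B.proj (t x) = x :=
    let ⟨W, _, hxW, hWt⟩ := h x hx
    hB.proj_section _ hWt x hxW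
  refine (hB.mem_smoothSections_iff V t hV proj_t).2 fun τ hτ => ?_
  choose! l hl using fun x (hx : x ∈ τ.1 ∩ V) => (hB.existsUnique_act (τ.2 x) (t x)
    ((hB.proj_section τ hτ x hx.1).trans (proj_t x hx.2).symm)).exists
  refine ⟨l, smoothIntoGroup_of_locally fun x hx => ?_, fun x hx => (hl x hx).symm⟩
  obtain ⟨W, _, hxW, hWt⟩ := h x hx.2
  obtain ⟨r, smooth_r, hr⟩ := hB.exists_transition hτ hWt
  refine ⟨W, hB.isOpen _ hWt, hxW, (smooth_r.mono fun y hy => ⟨hy.1.1, hy.2⟩).congr fun y hy => ?_⟩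
  exact hB.act_injective _ ((hl y hy.1).trans (hr y ⟨hy.1.1, hy.2⟩))

end IsPrincipalBundle

theorem IsPrincipalMorphism.exists_section {G H P Q : Type*} [Group G] [Group H]
    [SmoothCoordinates G] {φ : G →* H} {B : PrincipalBundleData M G P}
    {C : PrincipalBundleData M H Q} {f : P → Q} (hf : IsPrincipalMorphism φ B C f)
    (hB : IsPrincipalBundle m B) (x : M) : ∃ τ ∈ C.smoothSections, x ∈ τ.1 :=
  let ⟨σ, hσ, hx⟩ := hB.exists_section x
  ⟨_, hf.map_section σ hσ, hx⟩

variable (m M) in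
/-- `φ` is a smooth surjective submersion, as tested by maps from `M`: smooth maps to `G` have
smooth images in `H`, and smooth maps to `H` lift locally to smooth maps to `G`. -/
structure IsSurjectiveSubmersion {G H : Type*} [Group G] [SmoothCoordinates G] [Group H]
    [SmoothCoordinates H] (φ : G →* H) : Prop where
  smooth_comp : ∀ {U : Set M} {k : M → G}, SmoothIntoGroup m k U →
    SmoothIntoGroup m (fun x => φ (k x)) U
  liftsSmoothlyAt : ∀ {U : Set M} {h : M → H}, IsOpen U → SmoothIntoGroup m h U →
    ∀ {x₀ : M}, x₀ ∈ U → LiftsSmoothlyAt m φ h x₀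

theorem isSurjectiveSubmersion_spinCover (n : ℕ) : IsSurjectiveSubmersion m M (spinCover n) :=
  ⟨SmoothIntoGroup.spinCover, liftsSmoothlyAt_spinCover⟩

end principalBundles

section fibreProduct

variable {M G H P Q R : Type*} [Group G] [Group H] {φ : G →* H} {K : Subgroup H} {L : Subgroup G}
  {ψ : L →* K} {hψ : ∀ a : L, (ψ a : H) = φ a} {B : PrincipalBundleData M G P}
  {C : PrincipalBundleData M K Q} {F : PrincipalBundleData M H R} {lam : P → R} {i : Q → R}
  {hlam : IsPrincipalMorphism φ B F lam} {hi : IsPrincipalMorphism K.subtype C F i}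

include hlam hi in
theorem proj_snd_eq_proj_fst (z : {z : P × Q // lam z.1 = i z.2}) :
    C.proj z.1.2 = B.proj z.1.1 := by
  rw [← hi.proj_map, ← z.2, hlam.proj_map]

theorem isPrincipalMorphism_fibreProduct_fst :
    IsPrincipalMorphism L.subtype (fibreProduct ψ hψ hlam hi) B (fun z => z.1.1) :=
  ⟨fun _ => rfl, fun _ _ => rfl, fun _ hσ => hσ.1⟩

theorem isPrincipalMorphism_fibreProduct_snd :
    IsPrincipalMorphism ψ (fibreProduct ψ hψ hlam hi) C (fun z => z.1.2) :=
  ⟨proj_snd_eq_proj_fst (hlam := hlam) (hi := hi), fun _ _ => rfl, fun _ hσ => hσ.2⟩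

variable {m : ℕ} [TopologicalSpace M] [ChartedSpace (EuclideanSpace ℝ (Fin m)) M]
  [SmoothCoordinates G] [SmoothCoordinates H]

theorem fibreProduct_existsUnique_act (hB : IsPrincipalBundle m B) (hC : IsPrincipalBundle m C)
    (hF : IsPrincipalBundle m F) (hL : K.comap φ ≤ L) {z w : {z : P × Q // lam z.1 = i z.2}}
    (hzw : B.proj z.1.1 = B.proj w.1.1) : ∃! a, (fibreProduct ψ hψ hlam hi).act z a = w := by
  obtain ⟨a, ha, a_unique⟩ := hB.existsUnique_act z.1.1 w.1.1 hzw
  obtain ⟨b, hb, -⟩ := hC.existsUnique_act z.1.2 w.1.2 <| by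
    rw [proj_snd_eq_proj_fst (hlam := hlam) (hi := hi), hzw,
      proj_snd_eq_proj_fst (hlam := hlam) (hi := hi)]
  have hab : φ a = b := hF.act_injective (lam z.1.1) <| calc
    F.act (lam z.1.1) (φ a) = lam w.1.1 := by rw [← hlam.map_act, ha]
    _ = i (C.act z.1.2 b) := by rw [w.2, hb]
    _ = F.act (lam z.1.1) b := by rw [hi.map_act, z.2, Subgroup.coe_subtype]
  have haL : a ∈ L := hL (Subgroup.mem_comap.2 (hab ▸ b.2))
  have hψa : ψ ⟨a, haL⟩ = b := Subtype.ext ((hψ _).trans hab)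
  exact ⟨⟨a, haL⟩, Subtype.ext (Prod.ext ha ((congrArg (C.act z.1.2) hψa).trans hb)),
    fun c hc => Subtype.ext (a_unique c (congrArg (fun z => z.1.1) hc))⟩

theorem fibreProduct_exists_section (hB : IsPrincipalBundle m B) (hC : IsPrincipalBundle m C)
    (hF : IsPrincipalBundle m F) (hG : HasSmoothMul m M G) (hH : HasSmoothMul m M H)
    (hφ : IsSurjectiveSubmersion m M φ) (x : M) :
    ∃ σ ∈ (fibreProduct ψ hψ hlam hi).smoothSections, x ∈ σ.1 := by
  obtain ⟨σ, hσ, hxσ⟩ := hB.exists_section x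
  obtain ⟨τ, hτ, hxτ⟩ := hC.exists_section x
  obtain ⟨h, smooth_h, hh⟩ := hF.exists_transition (hlam.map_section σ hσ) (hi.map_section τ hτ)
  have hU : IsOpen (σ.1 ∩ τ.1) := (hB.isOpen σ hσ).inter (hC.isOpen τ hτ)
  obtain ⟨W', hW', hxW', k, smooth_k, hk⟩ := hφ.liftsSmoothlyAt hU smooth_h ⟨hxσ, hxτ⟩
  let W : Set M := σ.1 ∩ τ.1 ∩ W'
  have hW : IsOpen W := hU.inter hW'
  have mem_fibreProduct (y : M) (hy : y ∈ W) : lam (B.act (σ.2 y) (k y)) = i (τ.2 y) := by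
    rw [hlam.map_act, hk y hy.2]
    exact (hh y hy.1).symm
  have hxW : x ∈ W := ⟨⟨hxσ, hxτ⟩, hxW'⟩
  have : Nonempty {z : P × Q // lam z.1 = i z.2} := ⟨⟨(_, _), mem_fibreProduct x hxW⟩⟩
  choose! t ht using fun y (hy : y ∈ W) =>
    (⟨⟨(_, _), mem_fibreProduct y hy⟩, rfl⟩ :
      ∃ z : {z : P × Q // lam z.1 = i z.2}, z.1 = (B.act (σ.2 y) (k y), τ.2 y))
  have smooth_fst : (W, fun y => (t y).1.1) ∈ B.smoothSections :=
    hB.mem_smoothSections_of_act hG hσ hW (fun y hy => hy.1.1)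
      (smooth_k.mono Set.inter_subset_right) fun y hy => by rw [ht y hy]
  have smooth_snd : (W, fun y => (t y).1.2) ∈ C.smoothSections :=
    hC.mem_smoothSections_of_act (hH.subgroup K) hτ hW (fun y hy => hy.1.2) (k := fun _ => 1)
      (fun _ _ => contMDiffOn_const) fun y hy => by rw [ht y hy, hC.act_one]
  exact ⟨(W, t), ⟨smooth_fst, smooth_snd⟩, hxW⟩

theorem fibreProduct_mem_smoothSections_of_act (hB : IsPrincipalBundle m B)
    (hC : IsPrincipalBundle m C) (hG : HasSmoothMul m M G) (hH : HasSmoothMul m M H)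
    (hφ : IsSurjectiveSubmersion m M φ) {σ : Set M × (M → {z : P × Q // lam z.1 = i z.2})}
    (hσ : σ ∈ (fibreProduct ψ hψ hlam hi).smoothSections) {W : Set M} (hW : IsOpen W)
    (hWσ : W ⊆ σ.1) {k : M → L} (hk : SmoothIntoGroup m k W)
    {t : M → {z : P × Q // lam z.1 = i z.2}}
    (ht : ∀ x ∈ W, t x = (fibreProduct ψ hψ hlam hi).act (σ.2 x) (k x)) :
    (W, t) ∈ (fibreProduct ψ hψ hlam hi).smoothSections := by
  have smooth_ψ : SmoothIntoGroup m (fun x => ψ (k x)) W := smoothIntoGroup_subgroup_iff.2 <|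
    (hφ.smooth_comp (smoothIntoGroup_subgroup_iff.1 hk)).congr fun x _ => hψ (k x)
  exact ⟨hB.mem_smoothSections_of_act hG hσ.1 hW hWσ (smoothIntoGroup_subgroup_iff.1 hk)
      fun x hx => congrArg (fun z => z.1.1) (ht x hx),
    hC.mem_smoothSections_of_act (hH.subgroup K) hσ.2 hW hWσ smooth_ψ
      fun x hx => congrArg (fun z => z.1.2) (ht x hx)⟩

theorem fibreProduct_exists_transition (hB : IsPrincipalBundle m B) (hC : IsPrincipalBundle m C)
    (hF : IsPrincipalBundle m F) (hL : K.comap φ ≤ L)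
    {σ τ : Set M × (M → {z : P × Q // lam z.1 = i z.2})}
    (hσ : σ ∈ (fibreProduct ψ hψ hlam hi).smoothSections)
    (hτ : τ ∈ (fibreProduct ψ hψ hlam hi).smoothSections) :
    ∃ h : M → L, SmoothIntoGroup m h (σ.1 ∩ τ.1) ∧
      ∀ x ∈ σ.1 ∩ τ.1, τ.2 x = (fibreProduct ψ hψ hlam hi).act (σ.2 x) (h x) := by
  obtain ⟨h, smooth_h, hh⟩ := hB.exists_transition hσ.1 hτ.1
  choose! l hl using fun x (hx : x ∈ σ.1 ∩ τ.1) => (fibreProduct_existsUnique_act (ψ := ψ)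
    (hψ := hψ) (hlam := hlam) (hi := hi) hB hC hF hL
    ((hB.proj_section _ hσ.1 x hx.1).trans (hB.proj_section _ hτ.1 x hx.2).symm)).exists
  refine ⟨l, smoothIntoGroup_subgroup_iff.2 (smooth_h.congr fun x hx => ?_),
    fun x hx => (hl x hx).symm⟩
  exact hB.act_injective _ ((congrArg (fun z => z.1.1) (hl x hx)).trans (hh x hx))

theorem fibreProduct_isPrincipalBundle (hB : IsPrincipalBundle m B) (hC : IsPrincipalBundle m C)
    (hF : IsPrincipalBundle m F) (hG : HasSmoothMul m M G) (hH : HasSmoothMul m M H)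
    (hφ : IsSurjectiveSubmersion m M φ) (hL : K.comap φ ≤ L) :
    IsPrincipalBundle m (fibreProduct ψ hψ hlam hi) where
  act_one z := Subtype.ext <| Prod.ext (hB.act_one _) <|
    (congrArg (C.act z.1.2) (map_one ψ)).trans (hC.act_one _)
  act_mul z a b := Subtype.ext <| Prod.ext (hB.act_mul _ _ _) <|
    (congrArg (C.act z.1.2) (map_mul ψ a b)).trans (hC.act_mul _ _ _)
  proj_act z a := hB.proj_act _ _
  existsUnique_act _ _ := fibreProduct_existsUnique_act hB hC hF hL
  isOpen σ hσ := hB.isOpen _ hσ.1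
  proj_section σ hσ := hB.proj_section _ hσ.1
  exists_section := fibreProduct_exists_section hB hC hF hG hH hφ
  mem_smoothSections_iff V t hV _ := by
    refine ⟨fun ht' σ hσ => fibreProduct_exists_transition hB hC hF hL hσ ht', fun h => ?_⟩
    have smooth_near (x : M) (hx : x ∈ V) :
        ∃ W ⊆ V, x ∈ W ∧ (W, t) ∈ (fibreProduct ψ hψ hlam hi).smoothSections := by
      obtain ⟨σ, hσ, hxσ⟩ := fibreProduct_exists_section (ψ := ψ) (hψ := hψ) (hlam := hlam)
        (hi := hi) hB hC hF hG hH hφ x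
      obtain ⟨k, smooth_k, hk⟩ := h σ hσ
      exact ⟨σ.1 ∩ V, Set.inter_subset_right, ⟨hxσ, hx⟩,
        fibreProduct_mem_smoothSections_of_act hB hC hG hH hφ hσ ((hB.isOpen _ hσ.1).inter hV)
          Set.inter_subset_left smooth_k hk⟩
    exact ⟨hB.mem_smoothSections_of_locally fun x hx =>
        let ⟨W, hWV, hxW, hWt⟩ := smooth_near x hx
        ⟨W, hWV, hxW, hWt.1⟩,
      hC.mem_smoothSections_of_locally fun x hx =>
        let ⟨W, hWV, hxW, hWt⟩ := smooth_near x hx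
        ⟨W, hWV, hxW, hWt.2⟩⟩

end fibreProduct

end

theorem proposition2_general {N : ℕ} {D : Fin N → ℕ} (hD : 0 < ∑ i, D i) {m : ℕ} {M : Type*}
    [TopologicalSpace M] [ChartedSpace (EuclideanSpace ℝ (Fin m)) M] {P Q R : Type*}
    {B : PrincipalBundleData M (SpinGroup (∑ i, D i)) P} {C : PrincipalBundleData M (soProduct D) Q}
    {F : PrincipalBundleData M (SOGroup (∑ i, D i)) R} (hB : IsPrincipalBundle m B)
    (hC : IsPrincipalBundle m C) (hF : IsPrincipalBundle m F) {lam : P → R} {incl : Q → R}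
    (hlam : IsPrincipalMorphism (spinCover _) B F lam)
    (hi : IsPrincipalMorphism (soProduct D).subtype C F incl) :
    IsReduction m (spinProduct D) (fibreProduct (spinProductCover D) (fun _ => rfl) hlam hi) B
        (fun z => z.1.1) ∧
      IsPrincipalMorphism (spinProductCover D)
        (fibreProduct (spinProductCover D) (fun _ => rfl) hlam hi) C (fun z => z.1.2) :=
  ⟨⟨fibreProduct_isPrincipalBundle hB hC hF (hasSmoothMul_spin _) (hasSmoothMul_so _)
      (isSurjectiveSubmersion_spinCover _) (comap_spinCover_soProduct_le hD),
    isPrincipalMorphism_fibreProduct_fst⟩, isPrincipalMorphism_fibreProduct_snd⟩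

theorem proposition2 {N : ℕ} (hN : 0 < N) (D : Fin N → ℕ) (hD : ∀ i, 0 < D i)
    {M : Type*} [TopologicalSpace M] [ChartedSpace (EuclideanSpace ℝ (Fin (∑ i, D i))) M]
    [IsManifold (𝓡 (∑ i, D i)) ∞ M]
    (g : RiemannianMetricOn (∑ i, D i) M) (o : ManifoldOrientation (∑ i, D i) M)
    {P Q : Type*} (B : PrincipalBundleData M (SpinGroup (∑ i, D i)) P)
    (lam : P → OrthonormalFrames g o) (hlam : IsSpinStructure g o B lam)
    (C : PrincipalBundleData M (soProduct D) Q)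
    (incl : Q → OrthonormalFrames g o)
    (hi : IsReduction (∑ i, D i) (soProduct D) C (frameBundle g o) incl) :
    IsReduction (∑ i, D i) (spinProduct D)
        (fibreProduct (spinProductCover D) (fun _ => rfl) hlam.isPrincipalMorphism
          hi.isPrincipalMorphism)
        B (fun z => z.1.1) ∧
      IsPrincipalMorphism (spinProductCover D)
        (fibreProduct (spinProductCover D) (fun _ => rfl) hlam.isPrincipalMorphism
          hi.isPrincipalMorphism)
        C (fun z => z.1.2) := by
  exact proposition2_general (Finset.sum_pos (fun i _ => hD i) ⟨⟨0, hN⟩, Finset.mem_univ _⟩)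
    hlam.isPrincipalBundle hi.isPrincipalBundle
    (frameBundle_isPrincipalBundle
      (hlam.isPrincipalMorphism.exists_section hlam.isPrincipalBundle)) _ _
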